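/- Let $\varphi(\xi)=\xi/(1+\xi^2)$ and, for $t\in\mathbb{R}$, let $S(t)=e^{-it\varphi(D)}$, $D=-i\partial_x$, be the group of the linear BBM equation on the line, i.e. the Fourier multiplier on $\mathscr{S}'(\mathbb{R})$ given by $\widehat{S(t)f}(\xi)=e^{-it\varphi(\xi)}\widehat f(\xi)$ (with $\widehat f(\xi)=\int e^{-ix\xi}f(x)\,dx$ for $f\in\mathscr{S}(\mathbb{R})$). Fix a smooth function $\rho:\mathbb{R}\to[0,1]$ with $\rho(\xi)=1$ for $|\xi|\le\frac12$ and $\rho(\xi)=0$ for $|\xi|\ge1$, and put, for $k\in\mathbb{Z}$, $$\sigma_k(\xi)=\rho(\xi-k)\Big(\sum_{l\in\mathbb{Z}}\rho(\xi-l)\Big)^{-1},\qquad \square_k=\mathscr{F}^{-1}\sigma_k\mathscr{F}.$$ For $s\in\mathbb{R}$, $1\le p\le\infty$, $0<q<\infty$ and $f\in\mathscr{S}'(\mathbb{R})$ let $$\|f\|_{M^s_{p,q}}=\Big(\sum_{k\in\mathbb{Z}}(1+|k|)^{sq}\|\square_kf\|_{L^p}^q\Big)^{1/q}\in[0,\infty]$$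 (with $\|g\|_{L^p}=\infty$ if $g\in\mathscr{S}'(\mathbb{R})$ is not in $L^p$), and let $M^s_{p,q}$ be the space of those $f$ for which this is finite. For $\sigma<-1$ let $$\beta_\sigma=\begin{cases}\dfrac{\sigma+1}{1-2\sigma},&-4\le\sigma<-1,\\[2mm] \dfrac{-3}{1-2\sigma},&\sigma\le-4.\end{cases}$$ Let $s\in\mathbb{R}$, $\sigma<-1$, $2\le p<\infty$, $\frac1p+\frac1{p'}=1$, $0<q<\infty$ and $\theta\in[0,1]$. Then there is a constant $C$, depending only on $\rho,s,\sigma,p,q,\theta$, such that for all $t\in\mathbb{R}$ and all $f\in M^{s-\sigma\theta}_{p',q}$ one has $S(t)f\in M^s_{p,q}$ and $$\|S(t)f\|_{M^s_{p,q}}\le C\,(1+|t|)^{2\theta\left(\frac12-\frac1p\right)\beta_\sigma}\,\|f\|_{M^{s-\sigma\theta}_{p',q}}.$$ -/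

import Mathlib

open scoped SchwartzMap ENNReal NNReal ContDiff
open MeasureTheory

noncomputable section

namespace BBM

/-- The multiplier operator `m(D)`, `D = -i ∂ₓ`, on tempered distributions on the real line. Here
`m` is a function of the angular frequency (the variable dual to `x` through `e^{i x ξ}`); Mathlib's
Fourier transform is built on `e^{-2 π i x ξ}`, so its frequency `ξ` is the angular frequency
`2 π ξ`. -/
def multiplier (m : ℝ → ℂ) : 𝓢'(ℝ, ℂ) →L[ℂ] 𝓢'(ℝ, ℂ) :=
  TemperedDistribution.fourierMultiplierCLM ℂ (fun ξ : ℝ => m (2 * Real.pi * ξ))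

/-- The symbol `φ(ξ) = ξ / (1 + ξ²)`. -/
def phi (ξ : ℝ) : ℝ := ξ / (1 + ξ ^ 2)

/-- The BBM group `S(t) = e^{-i t φ(D)}`. -/
def group (t : ℝ) : 𝓢'(ℝ, ℂ) →L[ℂ] 𝓢'(ℝ, ℂ) :=
  multiplier (fun ξ => Complex.exp (-(Complex.I * (t * phi ξ : ℝ))))

/-- The smooth cut-off functions `ρ : ℝ → [0, 1]` from which the frequency-uniform decomposition is
built. -/
structure IsCutoff (ρ : ℝ → ℝ) : Prop where
  smooth : ContDiff ℝ ∞ ρ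
  mem_Icc : ∀ ξ, ρ ξ ∈ Set.Icc (0 : ℝ) 1
  eq_one : ∀ ξ, |ξ| ≤ 1 / 2 → ρ ξ = 1
  eq_zero : ∀ ξ, 1 ≤ |ξ| → ρ ξ = 0

/-- `σ_k(ξ) = ρ(ξ - k) / ∑_l ρ(ξ - l)`. -/
def sigma (ρ : ℝ → ℝ) (k : ℤ) (ξ : ℝ) : ℝ := ρ (ξ - k) * (∑' l : ℤ, ρ (ξ - l))⁻¹

/-- The frequency-uniform decomposition operators `□_k = 𝓕⁻¹ σ_k 𝓕`. -/
def box (ρ : ℝ → ℝ) (k : ℤ) : 𝓢'(ℝ, ℂ) →L[ℂ] 𝓢'(ℝ, ℂ) :=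
  multiplier (fun ξ => (sigma ρ k ξ : ℂ))

/-- The `L^p` norm, `1 ≤ p ≤ ∞`, of a tempered distribution: the norm of the `L^p` function that
represents it, and `∞` if there is none. -/
def lpNorm (p : ℝ≥0∞) (f : 𝓢'(ℝ, ℂ)) : ℝ≥0∞ :=
  ⨅ (g : ℝ → ℂ) (_ : MemLp g p volume) (_ : ∀ u : 𝓢(ℝ, ℂ), f u = ∫ x, u x * g x),
    eLpNorm g p volume

/-- The (quasi-)norm of the modulation space `M^s_{p,q}`, `1 ≤ p ≤ ∞`, `0 < q < ∞`, with value `∞`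
exactly at the tempered distributions outside `M^s_{p,q}`. -/
def modNorm (ρ : ℝ → ℝ) (s : ℝ) (p : ℝ≥0∞) (q : ℝ) (f : 𝓢'(ℝ, ℂ)) : ℝ≥0∞ :=
  (∑' k : ℤ, ENNReal.ofReal ((1 + |(k : ℝ)|) ^ (s * q)) * lpNorm p (box ρ k f) ^ q) ^ (1 / q)

/-- The decay exponent `β_σ`, used for `σ < -1`. -/
def beta (σ : ℝ) : ℝ :=
  if -4 ≤ σ then (σ + 1) / (1 - 2 * σ) else -3 / (1 - 2 * σ)

end BBM

end

/-! The proof works block by block. The kernel of `□_k S(t)` is an oscillatory integral with phase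
`xξ - tφ(ξ)` over the window `|ξ - k| ≤ 1`. The only zeros of `φ''` are the simple ones `0, ±√3`, so
on the window, at distance `δ` from them, `|φ''| ≥ δ / (2(2 + |k|)⁴)`. Van der Corput's second
derivative estimate away from the zeros and the trivial estimate near them balance when `|t|δ³ = (2
+ |k|)⁴`. The kernel is therefore at most `C min(1, Q)` with `Q = (1 + |t|)^(-1/3) (2 + |k|)^(4/3)`
(`IsCutoff.exists_norm_fourierInv_symbol_le`).

A symbol bounded by `1` acts on `L²` with norm at most `1`, and a kernel bounded by `A` maps `L¹` to
`L^∞` with norm at most `A`. Riesz-Thorin then gives the `L^{p'} → L^p` bound `A^(1 - 2/p)`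
(`lpNorm_fourierMultiplierCLM_le`). It is obtained from the three lines theorem for finite bilinear
forms and carried over to simple functions, to Schwartz functions and finally to distributions
represented in `L^{p'}`.

For the exponents, `min(1, Q) ≤ Q^γ` whenever `0 ≤ γ ≤ 1`. The choice `γ = -3β_σθ` is admissible
because `-1/3 ≤ β_σ ≤ 0`, and it yields exactly the required power of `1 + |t|`. The frequency loss
`-4β_σθ(1 - 2/p)` is at most `-σθ`, since `-4β_σ ≤ -σ`.

Finally `□_k = □_k(□_{k-1} + □_k + □_{k+1})` bounds a block of `S(t)f` by three blocks of `f`.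
Neighbouring weights are comparable, so the `ℓ^q` sums can be compared (`tsum_rpow_le_of_le_sum`).
-/

/-! ### Riesz-Thorin for finite bilinear forms. -/

/-- The analytic family `z ↦ sgn(a) |a|^{r (1 - z / 2)}` through a complex number `a`. -/
noncomputable def analyticPower (r : ℝ) (a z : ℂ) : ℂ :=
  a / (‖a‖ : ℂ) * Complex.exp ((Real.log ‖a‖ : ℂ) * ((r : ℂ) * (1 - z / 2)))

theorem differentiable_analyticPower (r : ℝ) (a : ℂ) : Differentiable ℂ (analyticPower r a) := by
  unfold analyticPower
  fun_prop

/-- The exponent must be nonzero because of `a = 0`: there the left side is `0`, whereas `0 ^ 0 =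
1`. -/
theorem norm_analyticPower {r : ℝ} (a z : ℂ) (h : r * (1 - z.re / 2) ≠ 0) :
    ‖analyticPower r a z‖ = ‖a‖ ^ (r * (1 - z.re / 2)) := by
  unfold analyticPower
  rcases eq_or_ne a 0 with rfl | ha
  · simp [Real.zero_rpow h]
  · have ha' : 0 < ‖a‖ := norm_pos_iff.2 ha
    have hre : ((Real.log ‖a‖ : ℂ) * ((r : ℂ) * (1 - z / 2))).re
        = Real.log ‖a‖ * (r * (1 - z.re / 2)) := by
      rw [Complex.re_ofReal_mul, Complex.re_ofReal_mul]
      simp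
    rw [norm_mul, Complex.norm_exp, hre, Real.rpow_def_of_pos ha', norm_div, Complex.norm_real,
      norm_norm, div_self ha'.ne', one_mul]

theorem analyticPower_eq_self {r : ℝ} (a z : ℂ) (h : (r : ℂ) * (1 - z / 2) = 1) :
    analyticPower r a z = a := by
  unfold analyticPower
  rcases eq_or_ne a 0 with rfl | ha
  · simp
  · have ha' : 0 < ‖a‖ := norm_pos_iff.2 ha
    rw [h, mul_one, ← Complex.ofReal_exp, Real.exp_log ha', div_mul_cancel₀]
    exact_mod_cast ha'.ne'

/-- A bound independent of `z` in the strip, for the boundedness hypothesis of the three lines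
theorem. -/
theorem norm_analyticPower_le {r : ℝ} (hr : 0 ≤ r) (a z : ℂ) (h0 : 0 ≤ z.re) (h1 : z.re ≤ 1) :
    ‖analyticPower r a z‖ ≤ Real.exp (|Real.log ‖a‖| * r) := by
  unfold analyticPower
  have hre : ((Real.log ‖a‖ : ℂ) * ((r : ℂ) * (1 - z / 2))).re
      = Real.log ‖a‖ * (r * (1 - z.re / 2)) := by
    rw [Complex.re_ofReal_mul, Complex.re_ofReal_mul]
    simp
  rw [norm_mul, Complex.norm_exp, hre]
  have h2 : ‖a / (‖a‖ : ℂ)‖ ≤ 1 := by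
    rw [norm_div, Complex.norm_real, norm_norm]
    exact div_self_le_one _
  refine (mul_le_of_le_one_left (Real.exp_pos _).le h2).trans (Real.exp_le_exp.2 ?_)
  refine mul_le_mul (le_abs_self _) ?_ (mul_nonneg hr (by linarith)) (abs_nonneg _)
  exact mul_le_of_le_one_right hr (by linarith)

/-- Riesz-Thorin interpolation between `ℓ¹ × ℓ¹` and `ℓ² × ℓ²` for finite bilinear forms on weighted
sequence spaces. -/
theorem norm_bilinear_le_of_interpolation {ι κ : Type*} (I : Finset ι) (J : Finset κ)
    (c : ι → κ → ℂ) (μ : ι → ℝ) (ν : κ → ℝ) (hμ : ∀ i, 0 ≤ μ i) (hν : ∀ j, 0 ≤ ν j)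
    {A : ℝ} (hA : 0 ≤ A)
    (h1 : ∀ (a : ι → ℂ) (b : κ → ℂ), ‖∑ i ∈ I, ∑ j ∈ J, c i j * a i * b j‖
      ≤ A * ((∑ i ∈ I, μ i * ‖a i‖) * ∑ j ∈ J, ν j * ‖b j‖))
    (h2 : ∀ (a : ι → ℂ) (b : κ → ℂ), ‖∑ i ∈ I, ∑ j ∈ J, c i j * a i * b j‖
      ≤ ((∑ i ∈ I, μ i * ‖a i‖ ^ (2 : ℝ)) * ∑ j ∈ J, ν j * ‖b j‖ ^ (2 : ℝ)) ^ (1 / 2 : ℝ))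
    {p r : ℝ} (hp : 2 ≤ p) (hpr : 1 / p + 1 / r = 1) (a : ι → ℂ) (b : κ → ℂ) :
    ‖∑ i ∈ I, ∑ j ∈ J, c i j * a i * b j‖ ≤ A ^ (1 - 2 / p) *
      ((∑ i ∈ I, μ i * ‖a i‖ ^ r) * ∑ j ∈ J, ν j * ‖b j‖ ^ r) ^ (1 / r) := by
  have hp0 : 0 < p := by linarith
  have hr1 : 1 / r = 1 - 1 / p := by linarith
  have hp2 : 1 / p ≤ 1 / 2 := one_div_le_one_div_of_le (by norm_num) hp
  have hp3 : 0 < 1 / p := by positivity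
  have hr0 : 0 < r := by
    have : 0 < 1 / r := by rw [hr1]; linarith
    exact one_div_pos.1 this
  set S := ∑ i ∈ I, μ i * ‖a i‖ ^ r with hS
  set T := ∑ j ∈ J, ν j * ‖b j‖ ^ r with hT
  have hS0 : 0 ≤ S := Finset.sum_nonneg fun i _ => mul_nonneg (hμ i) (by positivity)
  have hT0 : 0 ≤ T := Finset.sum_nonneg fun i _ => mul_nonneg (hν i) (by positivity)
  let F : ℂ → ℂ := fun z => ∑ i ∈ I, ∑ j ∈ J, c i j * analyticPower r (a i) z *
    analyticPower r (b j) z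
  have hF : Differentiable ℂ F := by
    refine Differentiable.fun_sum fun i _ => Differentiable.fun_sum fun j _ => ?_
    exact ((differentiable_analyticPower r (a i)).const_mul _).mul
      (differentiable_analyticPower r (b j))
  have hz : ((2 / p : ℝ) : ℂ) ∈ Complex.HadamardThreeLines.verticalClosedStrip 0 1 := by
    simp only [Complex.HadamardThreeLines.verticalClosedStrip, Set.mem_preimage, Complex.ofReal_re,
      Set.mem_Icc]
    refine ⟨by positivity, ?_⟩
    rw [div_le_one hp0]; exact hp
  have hB : BddAbove ((norm ∘ F) '' Complex.HadamardThreeLines.verticalClosedStrip 0 1) := by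
    refine ⟨∑ i ∈ I, ∑ j ∈ J, ‖c i j‖ * Real.exp (|Real.log ‖a i‖| * r) *
      Real.exp (|Real.log ‖b j‖| * r), ?_⟩
    rintro _ ⟨z, hz, rfl⟩
    refine (norm_sum_le _ _).trans (Finset.sum_le_sum fun i _ => (norm_sum_le _ _).trans
      (Finset.sum_le_sum fun j _ => ?_))
    rw [norm_mul, norm_mul]
    gcongr
    · exact norm_analyticPower_le hr0.le _ _ hz.1 hz.2
    · exact norm_analyticPower_le hr0.le _ _ hz.1 hz.2
  -- The moduli of the family are `|a|^r` on `Re z = 0` and `|a|^(r/2)` on `Re z = 1`. The endpoint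
  -- bounds thus become `A·S·T` and `(S·T)^(1/2)`, and at `z = 2/p` the family returns `a` and `b`.
  have key := Complex.HadamardThreeLines.norm_le_interp_of_mem_verticalClosedStrip₀₁' F
    (a := A * (S * T)) (b := (S * T) ^ (1 / 2 : ℝ)) hz hF.diffContOnCl hB ?_ ?_
  · have h3 : (r : ℂ) * (1 - ((2 / p : ℝ) : ℂ) / 2) = 1 := by
      have : r * (1 - (2 / p) / 2) = 1 := by
        have : 1 - (2 / p) / 2 = 1 / r := by rw [hr1]; ring
        rw [this]; field_simp
      exact_mod_cast this
    simp only [F, analyticPower_eq_self _ _ h3, Complex.ofReal_re] at key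
    refine key.trans (le_of_eq ?_)
    have h4 : 0 ≤ 1 - 2 / p := by
      rw [sub_nonneg, div_le_one hp0]; exact hp
    rw [Real.mul_rpow hA (mul_nonneg hS0 hT0), mul_assoc, ← Real.rpow_mul (mul_nonneg hS0 hT0),
      ← Real.rpow_add_of_nonneg (mul_nonneg hS0 hT0) h4 (by positivity)]
    congr 2
    rw [hr1]; ring
  · intro z hz
    have hz : z.re = 0 := hz
    have hn : ∀ x : ℂ, ‖analyticPower r x z‖ = ‖x‖ ^ r := fun x => by
      rw [norm_analyticPower _ _ (by rw [hz]; simpa using hr0.ne'), hz]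
      simp
    simpa only [hn] using h1 (fun i => analyticPower r (a i) z) (fun j => analyticPower r (b j) z)
  · intro z hz
    have hz : z.re = 1 := hz
    have hn : ∀ x : ℂ, ‖analyticPower r x z‖ ^ (2 : ℝ) = ‖x‖ ^ r := fun x => by
      rw [norm_analyticPower _ _ (by rw [hz]; norm_num; exact hr0.ne'), hz,
        ← Real.rpow_mul (norm_nonneg _)]
      congr 1; ring
    simpa only [hn] using h2 (fun i => analyticPower r (a i) z) (fun j => analyticPower r (b j) z)

/-! ### Convolution with a Schwartz kernel, and its `L¹ × L¹` bound. -/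

section Convolution

open scoped FourierTransform

/-- A bounded integrable function lies in every `L^q`, `1 ≤ q < ∞`. -/
theorem MeasureTheory.Integrable.memLp_of_norm_le {h : ℝ → ℂ} {C q : ℝ} (hi : Integrable h)
    (hC : ∀ x, ‖h x‖ ≤ C) (hq : 1 ≤ q) : MemLp h (ENNReal.ofReal q) := by
  have hq0 : 0 < q := by linarith
  have hC0 : 0 ≤ C := (norm_nonneg _).trans (hC 0)
  rw [← integrable_norm_rpow_iff hi.aestronglyMeasurable (by simpa using hq0) ENNReal.ofReal_ne_top,
    ENNReal.toReal_ofReal hq0.le]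
  refine (hi.norm.const_mul (C ^ (q - 1))).mono'
    (hi.aestronglyMeasurable.norm.aemeasurable.pow_const q).aestronglyMeasurable
    (Filter.Eventually.of_forall fun x => ?_)
  rw [Real.norm_of_nonneg (by positivity)]
  rcases (norm_nonneg (h x)).eq_or_lt with h0 | h0
  · rw [← h0, Real.zero_rpow hq0.ne', mul_zero]
  · calc ‖h x‖ ^ q = ‖h x‖ ^ (q - 1) * ‖h x‖ := by
          rw [← Real.rpow_add_one h0.ne', sub_add_cancel]
      _ ≤ _ := by
          gcongr
          exact hC x

/-- The convolution of a function with a Schwartz function. -/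
noncomputable def convSchwartz (K : 𝓢(ℝ, ℂ)) (f : ℝ → ℂ) (x : ℝ) : ℂ := ∫ t, f t * K (x - t)

theorem convSchwartz_congr (K : 𝓢(ℝ, ℂ)) {f g : ℝ → ℂ} (h : f =ᵐ[volume] g) :
    convSchwartz K f = convSchwartz K g := by
  ext x
  refine integral_congr_ae ?_
  filter_upwards [h] with t ht
  rw [ht]

theorem integrable_mul_schwartz_sub (K : 𝓢(ℝ, ℂ)) {f : ℝ → ℂ} (hf : Integrable f) (x : ℝ) :
    Integrable fun t => f t * K (x - t) := by
  have hm : AEStronglyMeasurable (fun t => K (x - t)) volume :=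
    (K.continuous.comp (continuous_const.sub continuous_id)).aestronglyMeasurable
  refine hf.mul_bdd (c := SchwartzMap.seminorm ℝ 0 0 K) hm ?_
  exact Filter.Eventually.of_forall fun t => SchwartzMap.norm_le_seminorm ℝ K _

theorem norm_convSchwartz_le (K : 𝓢(ℝ, ℂ)) {A : ℝ} (hA : ∀ x, ‖K x‖ ≤ A) {f : ℝ → ℂ}
    (hf : Integrable f) (x : ℝ) : ‖convSchwartz K f x‖ ≤ A * ∫ t, ‖f t‖ := by
  rw [← integral_const_mul]
  refine norm_integral_le_of_norm_le (hf.norm.const_mul A) (Filter.Eventually.of_forall fun t => ?_)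
  rw [norm_mul, mul_comm]
  gcongr
  exact hA _

theorem integrable_convSchwartz (K : 𝓢(ℝ, ℂ)) {f : ℝ → ℂ} (hf : Integrable f) :
    Integrable (convSchwartz K f) :=
  hf.integrable_convolution (.mul ℂ ℂ) K.integrable

theorem memLp_convSchwartz (K : 𝓢(ℝ, ℂ)) {f : ℝ → ℂ} (hf : Integrable f) {q : ℝ} (hq : 1 ≤ q) :
    MemLp (convSchwartz K f) (ENNReal.ofReal q) :=
  (integrable_convSchwartz K hf).memLp_of_norm_le
    (norm_convSchwartz_le K (SchwartzMap.norm_le_seminorm ℝ K) hf) hq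

/-- Convolution with the reflected kernel is the transpose of convolution. -/
theorem integral_convSchwartz_mul (K K' : 𝓢(ℝ, ℂ)) (hK : ∀ x, K' x = K (-x)) {f g : ℝ → ℂ}
    (hf : Integrable f) (hg : Integrable g) :
    ∫ x, convSchwartz K f x * g x = ∫ x, convSchwartz K' g x * f x := by
  have hint : Integrable (Function.uncurry fun x t => f t * K (x - t) * g x)
      (volume.prod volume) := by
    have h1 : Integrable (fun z : ℝ × ℝ => g z.1 * f z.2) (volume.prod volume) := hg.mul_prod hf
    have hm : AEStronglyMeasurable (fun z : ℝ × ℝ => K (z.1 - z.2)) (volume.prod volume) :=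
      (K.continuous.comp (continuous_fst.sub continuous_snd)).aestronglyMeasurable
    have := h1.mul_bdd (c := SchwartzMap.seminorm ℝ 0 0 K) hm
      (Filter.Eventually.of_forall fun t => SchwartzMap.norm_le_seminorm ℝ K _)
    refine this.congr (Filter.Eventually.of_forall fun z => ?_)
    simp only [Function.uncurry]
    ring
  calc ∫ x, convSchwartz K f x * g x = ∫ x, ∫ t, f t * K (x - t) * g x := by
        simp only [convSchwartz, integral_mul_const]
    _ = ∫ t, ∫ x, f t * K (x - t) * g x := integral_integral_swap hint
    _ = _ := by
        refine integral_congr_ae (Filter.Eventually.of_forall fun t => ?_)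
        simp only [convSchwartz]
        rw [← integral_mul_const]
        refine integral_congr_ae (Filter.Eventually.of_forall fun x => ?_)
        simp only [hK, neg_sub]
        ring

theorem norm_integral_convSchwartz_mul_le (K : 𝓢(ℝ, ℂ)) {A : ℝ} (hA : ∀ x, ‖K x‖ ≤ A)
    {f g : ℝ → ℂ} (hf : Integrable f) (hg : Integrable g) :
    ‖∫ x, convSchwartz K f x * g x‖ ≤ A * ((∫ t, ‖f t‖) * ∫ t, ‖g t‖) := by
  rw [← mul_assoc, ← integral_const_mul]
  refine norm_integral_le_of_norm_le (hg.norm.const_mul _) (Filter.Eventually.of_forall fun t => ?_)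
  rw [norm_mul]
  gcongr
  exact norm_convSchwartz_le K hA hf t

end Convolution

/-! ### Extending bounds from dense sets. -/

section Density

variable {P R : ℝ≥0∞} [Fact (1 ≤ P)] [Fact (1 ≤ R)] [ENNReal.HolderConjugate P R]

theorem continuous_integral_mul_Lp {h : ℝ → ℂ} (hh : MemLp h P) :
    Continuous fun g : Lp ℂ R (volume : Measure ℝ) => ∫ x, h x * g x := by
  have : (fun g : Lp ℂ R (volume : Measure ℝ) => ∫ x, h x * g x) =
      fun g => (ContinuousLinearMap.mul ℂ ℂ).lpPairing volume P R (hh.toLp h) g := by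
    ext g
    rw [ContinuousLinearMap.lpPairing_eq_integral]
    refine integral_congr_ae ?_
    filter_upwards [hh.coeFn_toLp] with x hx
    simp [hx]
  rw [this]
  exact ContinuousLinearMap.continuous _

/-- A bound for the pairing with a function extends from a dense set. -/
theorem norm_integral_mul_le_of_dense {h : ℝ → ℂ} (hh : MemLp h P) {M : ℝ}
    {D : Set (Lp ℂ R (volume : Measure ℝ))} (hD : Dense D)
    (hB : ∀ g ∈ D, ‖∫ x, h x * g x‖ ≤ M * ‖g‖) (g : Lp ℂ R (volume : Measure ℝ)) :
    ‖∫ x, h x * g x‖ ≤ M * ‖g‖ := by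
  have hcl : IsClosed {g : Lp ℂ R (volume : Measure ℝ) | ‖∫ x, h x * g x‖ ≤ M * ‖g‖} :=
    isClosed_le (continuous_integral_mul_Lp hh).norm (continuous_const.mul continuous_norm)
  exact hcl.closure_subset_iff.2 hB (hD g)

/-- A bound for the bilinear form of a convolution operator extends from a dense set of integrable
functions. -/
theorem norm_integral_convSchwartz_mul_le_of_dense {K K' : 𝓢(ℝ, ℂ)} (hK : ∀ x, K' x = K (-x))
    (hKP : ∀ (L : 𝓢(ℝ, ℂ)) (f : ℝ → ℂ), Integrable f → MemLp (convSchwartz L f) P) {M : ℝ}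
    {D : Set (Lp ℂ R (volume : Measure ℝ))} (hD : Dense D) (hDi : ∀ f ∈ D, Integrable f)
    (hB : ∀ f ∈ D, ∀ g ∈ D, ‖∫ x, convSchwartz K f x * g x‖ ≤ M * ‖f‖ * ‖g‖)
    {f g : Lp ℂ R (volume : Measure ℝ)} (hf : Integrable f) (hg : Integrable g) :
    ‖∫ x, convSchwartz K f x * g x‖ ≤ M * ‖f‖ * ‖g‖ := by
  -- The extension is made in one variable at a time. Transposing puts `f` in the free slot with `g`
  -- fixed; for `f ∈ D`, transposing back frees `g`.
  rw [integral_convSchwartz_mul K K' hK hf hg, mul_right_comm]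
  refine norm_integral_mul_le_of_dense (hKP K' g hg) hD (fun f hf => ?_) f
  rw [← integral_convSchwartz_mul K K' hK (hDi f hf) hg, mul_right_comm]
  exact norm_integral_mul_le_of_dense (hKP K f (hDi f hf)) hD (fun g hg => hB f hf g hg) g

end Density

/-! ### The converse of Hölder's inequality. -/

theorem norm_toLp_ofReal {q : ℝ} (hq : 0 < q) {h : ℝ → ℂ} (hh : MemLp h (ENNReal.ofReal q)) :
    ‖hh.toLp h‖ = (∫ x, ‖h x‖ ^ q) ^ (1 / q) := by
  rw [Lp.norm_toLp, hh.eLpNorm_eq_integral_rpow_norm (by simpa using hq) ENNReal.ofReal_ne_top,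
    ENNReal.toReal_ofReal hq.le, ENNReal.toReal_ofReal (by positivity), one_div]

/-- The converse of Hölder's inequality, for a function already known to be in `L^p`. -/
theorem norm_toLp_le_of_forall_integral_le {p r : ℝ} (hpr : p.HolderConjugate r)
    {h : ℝ → ℂ} (hh : MemLp h (ENNReal.ofReal p)) {M : ℝ} (hM : 0 ≤ M)
    (hB : ∀ g : Lp ℂ (ENNReal.ofReal r) (volume : Measure ℝ), ‖∫ x, h x * g x‖ ≤ M * ‖g‖) :
    ‖hh.toLp h‖ ≤ M := by
  have hp0 : 0 < p := hpr.pos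
  have hr0 : 0 < r := hpr.symm.pos
  have hpne : ENNReal.ofReal p ≠ 0 := by simpa using hp0
  have hrne : ENNReal.ofReal r ≠ 0 := by simpa using hr0
  have hp1 : 0 < p - 1 := by linarith [hpr.lt]
  -- The extremal function: `h g = |h|^p` and `|g|^r = |h|^p`. Division by zero makes it vanish
  -- where `h` does.
  let g : ℝ → ℂ := fun x => (starRingEnd ℂ) (h x) / (‖h x‖ : ℂ) * ((‖h x‖ ^ (p - 1) : ℝ) : ℂ)
  have hgn : ∀ x, ‖g x‖ = ‖h x‖ ^ (p - 1) := fun x => by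
    simp only [g, norm_mul, norm_div, Complex.norm_real, norm_norm, RCLike.norm_conj]
    rw [Real.norm_of_nonneg (by positivity)]
    rcases eq_or_ne (‖h x‖) 0 with h0 | h0
    · rw [h0, Real.zero_rpow hp1.ne', mul_zero]
    · rw [div_self h0, one_mul]
  have hhg : ∀ x, h x * g x = ((‖h x‖ ^ p : ℝ) : ℂ) := fun x => by
    simp only [g]
    rcases eq_or_ne (‖h x‖) 0 with h0 | h0
    · rw [h0, Real.zero_rpow hp0.ne', norm_eq_zero.1 h0]; simp
    · have e1 : ‖h x‖ ^ p = ‖h x‖ * ‖h x‖ ^ (p - 1) := by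
        rw [mul_comm, ← Real.rpow_add_one h0, sub_add_cancel]
      have e2 : h x * (starRingEnd ℂ) (h x) = (‖h x‖ : ℂ) * ‖h x‖ := by
        rw [Complex.mul_conj, Complex.normSq_eq_norm_sq]; push_cast; ring
      have h0' : (‖h x‖ : ℂ) ≠ 0 := by exact_mod_cast h0
      rw [e1, Complex.ofReal_mul, ← mul_assoc, ← mul_div_assoc, e2, mul_div_assoc, div_self h0',
        mul_one]
  have hgr : ∀ x, ‖g x‖ ^ r = ‖h x‖ ^ p := fun x => by
    rw [hgn, ← Real.rpow_mul (norm_nonneg _)]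
    congr 1
    exact hpr.sub_one_mul_conj
  have hgm : AEStronglyMeasurable g volume := by
    have := hh.aestronglyMeasurable.aemeasurable
    have e : AEMeasurable g volume :=
      ((Complex.continuous_conj.measurable.comp_aemeasurable this).div
        (Complex.measurable_ofReal.comp_aemeasurable this.norm)).mul
        (Complex.measurable_ofReal.comp_aemeasurable (this.norm.pow_const _))
    exact e.aestronglyMeasurable
  have hIi : Integrable fun x => ‖h x‖ ^ p := by
    have := hh.integrable_norm_rpow hpne ENNReal.ofReal_ne_top
    rwa [ENNReal.toReal_ofReal hp0.le] at this
  have hgL : MemLp g (ENNReal.ofReal r) := by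
    rw [← integrable_norm_rpow_iff hgm hrne ENNReal.ofReal_ne_top, ENNReal.toReal_ofReal hr0.le]
    simpa only [hgr] using hIi
  set I := ∫ x, ‖h x‖ ^ p with hI
  have hI0 : 0 ≤ I := integral_nonneg fun x => by positivity
  have hhI : ‖hh.toLp h‖ = I ^ (1 / p) := norm_toLp_ofReal hp0 hh
  have hgI : ‖hgL.toLp g‖ = I ^ (1 / r) := by
    rw [norm_toLp_ofReal hr0]
    simp only [hgr, hI]
  have key := hB (hgL.toLp g)
  have e1 : ∫ x, h x * hgL.toLp g x = (I : ℂ) := by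
    rw [hI, ← integral_complex_ofReal]
    refine integral_congr_ae ?_
    filter_upwards [hgL.coeFn_toLp] with x hx
    rw [hx, hhg]
  rw [e1, hgI, Complex.norm_real, Real.norm_of_nonneg hI0] at key
  rw [hhI]
  rcases hI0.eq_or_lt with h0 | h0
  · rw [← h0, Real.zero_rpow (by positivity)]; exact hM
  · have e2 : I = I ^ (1 / p) * I ^ (1 / r) := by
      rw [← Real.rpow_add h0, one_div, one_div, hpr.inv_add_inv_eq_one, Real.rpow_one]
    have e3 : 0 < I ^ (1 / r) := by positivity
    exact le_of_mul_le_mul_right (e2.symm.le.trans key) e3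

/-! ### Step functions and interpolation on simple functions. -/

section StepFunctions

variable {ι κ : Type*}

/-- The step function with the values `a i` on the sets `E i`. -/
noncomputable def stepFun (I : Finset ι) (E : ι → Set ℝ) (a : ι → ℂ) (x : ℝ) : ℂ :=
  ∑ i ∈ I, a i * (E i).indicator (fun _ => 1) x

/-- By disjointness at most one term is nonzero at each point, so the power passes through the sum.
-/
theorem norm_stepFun_rpow {I : Finset ι} {E : ι → Set ℝ}
    (hd : (I : Set ι).PairwiseDisjoint E) (a : ι → ℂ) {q : ℝ} (hq : 0 < q) (x : ℝ) :
    ‖stepFun I E a x‖ ^ q = ∑ i ∈ I, (E i).indicator (fun _ => ‖a i‖ ^ q) x := by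
  unfold stepFun
  by_cases h : ∃ i ∈ I, x ∈ E i
  · obtain ⟨i, hi, hx⟩ := h
    have hne : ∀ j ∈ I, j ≠ i → x ∉ E j := fun j hj hji hxj =>
      Set.disjoint_left.1 (hd hj hi hji) hxj hx
    rw [Finset.sum_eq_single_of_mem i hi fun j hj hji => by simp [hne j hj hji],
      Finset.sum_eq_single_of_mem i hi fun j hj hji => by simp [hne j hj hji]]
    simp [hx]
  · push Not at h
    rw [Finset.sum_eq_zero fun i hi => by simp [h i hi],
      Finset.sum_eq_zero fun i hi => by simp [h i hi]]
    simp [hq.ne']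

theorem integrable_indicator_one {E : Set ℝ} (hm : MeasurableSet E) (hf : volume E ≠ ⊤) :
    Integrable (E.indicator fun _ => (1 : ℂ)) :=
  (integrable_indicator_iff hm).2 (integrableOn_const hf)

theorem integrable_stepFun {I : Finset ι} {E : ι → Set ℝ} (hm : ∀ i ∈ I, MeasurableSet (E i))
    (hf : ∀ i ∈ I, volume (E i) ≠ ⊤) (a : ι → ℂ) : Integrable (stepFun I E a) :=
  integrable_finsetSum _ fun i hi => (integrable_indicator_one (hm i hi) (hf i hi)).const_mul _

theorem integral_norm_stepFun_rpow {I : Finset ι} {E : ι → Set ℝ}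
    (hd : (I : Set ι).PairwiseDisjoint E) (hm : ∀ i ∈ I, MeasurableSet (E i))
    (hf : ∀ i ∈ I, volume (E i) ≠ ⊤) (a : ι → ℂ) {q : ℝ} (hq : 0 < q) :
    ∫ x, ‖stepFun I E a x‖ ^ q = ∑ i ∈ I, volume.real (E i) * ‖a i‖ ^ q := by
  simp only [norm_stepFun_rpow hd a hq]
  rw [integral_finsetSum _ fun i hi =>
    (integrable_indicator_iff (hm i hi)).2 (integrableOn_const (hf i hi))]
  refine Finset.sum_congr rfl fun i hi => ?_
  rw [integral_indicator_const _ (hm i hi), smul_eq_mul]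

theorem convSchwartz_stepFun (K : 𝓢(ℝ, ℂ)) {I : Finset ι} {E : ι → Set ℝ}
    (hm : ∀ i ∈ I, MeasurableSet (E i)) (hf : ∀ i ∈ I, volume (E i) ≠ ⊤) (a : ι → ℂ) (x : ℝ) :
    convSchwartz K (stepFun I E a) x =
      ∑ i ∈ I, a i * convSchwartz K ((E i).indicator fun _ => 1) x := by
  simp only [convSchwartz, stepFun, Finset.sum_mul]
  rw [integral_finsetSum _ fun i hi => ?_]
  · simp only [mul_assoc, integral_const_mul]
  · exact integrable_mul_schwartz_sub K
      ((integrable_indicator_one (hm i hi) (hf i hi)).const_mul (a i)) x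

/-- This makes the pairing a finite bilinear form in the values `a`, `b`, which is the setting of
the interpolation lemma. -/
theorem integral_convSchwartz_stepFun_mul (K : 𝓢(ℝ, ℂ)) {I : Finset ι} {J : Finset κ}
    {E : ι → Set ℝ} {F : κ → Set ℝ}
    (hm : ∀ i ∈ I, MeasurableSet (E i)) (hf : ∀ i ∈ I, volume (E i) ≠ ⊤)
    (hm' : ∀ j ∈ J, MeasurableSet (F j)) (a : ι → ℂ) (b : κ → ℂ) :
    ∫ x, convSchwartz K (stepFun I E a) x * stepFun J F b x = ∑ i ∈ I, ∑ j ∈ J,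
      (∫ x, convSchwartz K ((E i).indicator fun _ => 1) x * (F j).indicator (fun _ => 1) x) *
        a i * b j := by
  have hi : ∀ i ∈ I, ∀ j ∈ J, Integrable fun x =>
      convSchwartz K ((E i).indicator fun _ => 1) x * (F j).indicator (fun _ => (1 : ℂ)) x :=
    fun i hi j hj => by
      have := (integrable_convSchwartz K (integrable_indicator_one (hm i hi) (hf i hi))).indicator
        (hm' j hj)
      refine this.congr (Filter.Eventually.of_forall fun x => ?_)
      by_cases hx : x ∈ F j <;> simp [hx]
  have e : ∀ x, convSchwartz K (stepFun I E a) x * stepFun J F b x = ∑ i ∈ I, ∑ j ∈ J,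
      (convSchwartz K ((E i).indicator fun _ => 1) x * (F j).indicator (fun _ => 1) x) *
        (a i * b j) := fun x => by
    rw [convSchwartz_stepFun K hm hf, stepFun, Finset.sum_mul_sum]
    refine Finset.sum_congr rfl fun i _ => Finset.sum_congr rfl fun j _ => ?_
    ring
  simp only [e]
  rw [integral_finsetSum _ fun i hi' => integrable_finsetSum _ fun j hj =>
    (hi i hi' j hj).mul_const _]
  refine Finset.sum_congr rfl fun i hi' => ?_
  rw [integral_finsetSum _ fun j hj => (hi i hi' j hj).mul_const _]
  refine Finset.sum_congr rfl fun j _ => ?_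
  rw [integral_mul_const, mul_assoc]

/-- The nonzero values of a simple function. -/
noncomputable def MeasureTheory.SimpleFunc.nonzeroRange (f : SimpleFunc ℝ ℂ) : Finset ℂ :=
  f.range.erase 0

theorem MeasureTheory.SimpleFunc.eq_stepFun (f : SimpleFunc ℝ ℂ) :
    ⇑f = stepFun f.nonzeroRange (fun c => f ⁻¹' {c}) id := by
  ext x
  unfold stepFun nonzeroRange
  rcases eq_or_ne (f x) 0 with h | h
  · rw [Finset.sum_eq_zero, h]
    intro c hc
    have : f x ≠ c := fun h' => (Finset.mem_erase.1 hc).1 (h'.symm.trans h)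
    simp [this]
  · rw [Finset.sum_eq_single_of_mem (f x) (Finset.mem_erase.2 ⟨h, f.mem_range_self x⟩)]
    · simp
    · intro c _ hc
      simp [hc.symm]

end StepFunctions

/-- Riesz-Thorin interpolation for a convolution operator, on simple functions. -/
theorem norm_integral_convSchwartz_simpleFunc_le (K : 𝓢(ℝ, ℂ)) {A : ℝ} (hA0 : 0 ≤ A)
    (hA : ∀ x, ‖K x‖ ≤ A)
    (h2 : ∀ f g : ℝ → ℂ, Integrable f → Integrable g → MemLp f 2 → MemLp g 2 →
      ‖∫ x, convSchwartz K f x * g x‖ ≤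
        ((∫ x, ‖f x‖ ^ (2 : ℝ)) * ∫ x, ‖g x‖ ^ (2 : ℝ)) ^ (1 / 2 : ℝ))
    {p r : ℝ} (hp : 2 ≤ p) (hpr : 1 / p + 1 / r = 1) (hr : 0 < r) (f g : SimpleFunc ℝ ℂ)
    (hf : Integrable f) (hg : Integrable g) :
    ‖∫ x, convSchwartz K f x * g x‖ ≤
      A ^ (1 - 2 / p) * ((∫ x, ‖f x‖ ^ r) * ∫ x, ‖g x‖ ^ r) ^ (1 / r) := by
  have hd : ∀ f : SimpleFunc ℝ ℂ,
      (f.nonzeroRange : Set ℂ).PairwiseDisjoint fun c => f ⁻¹' {c} := fun f c _ d _ hcd =>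
    Disjoint.preimage f (Set.disjoint_singleton.2 hcd)
  have hm : ∀ f : SimpleFunc ℝ ℂ, ∀ c ∈ f.nonzeroRange, MeasurableSet (f ⁻¹' {c}) := fun f c _ =>
    f.measurableSet_fiber c
  -- The value `0` is excluded since its level set has infinite measure.
  have hv : ∀ f : SimpleFunc ℝ ℂ, Integrable f → ∀ c ∈ f.nonzeroRange, volume (f ⁻¹' {c}) ≠ ⊤ :=
    fun f hf c hc => (f.measure_preimage_lt_top_of_integrable hf (Finset.mem_erase.1 hc).1).ne
  have hL2 : ∀ f : SimpleFunc ℝ ℂ, Integrable f → ∀ a,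
      MemLp (stepFun f.nonzeroRange (fun c => f ⁻¹' {c}) a) 2 := fun f hf a =>
    memLp_finsetSum _ fun c hc =>
      (memLp_indicator_const 2 (hm f c hc) (1 : ℂ) (Or.inr (hv f hf c hc))).const_mul (a c)
  have h1' : ∀ f : SimpleFunc ℝ ℂ, Integrable f → ∀ a,
      ∫ x, ‖stepFun f.nonzeroRange (fun c => f ⁻¹' {c}) a x‖ =
        ∑ c ∈ f.nonzeroRange, volume.real (f ⁻¹' {c}) * ‖a c‖ := fun f hf a => by
    simpa using integral_norm_stepFun_rpow (hd f) (hm f) (hv f hf) a one_pos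
  have key := norm_bilinear_le_of_interpolation f.nonzeroRange g.nonzeroRange
    (fun c d => ∫ x, convSchwartz K ((f ⁻¹' {c}).indicator fun _ => 1) x *
      (g ⁻¹' {d}).indicator (fun _ => 1) x) (fun c => volume.real (f ⁻¹' {c}))
    (fun c => volume.real (g ⁻¹' {c})) (fun _ => measureReal_nonneg) (fun _ => measureReal_nonneg)
    hA0 (fun a b => ?_) (fun a b => ?_) hp hpr id id
  · rw [← integral_convSchwartz_stepFun_mul K (hm f) (hv f hf) (hm g),
      ← integral_norm_stepFun_rpow (hd f) (hm f) (hv f hf) _ hr,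
      ← integral_norm_stepFun_rpow (hd g) (hm g) (hv g hg) _ hr] at key
    rwa [← f.eq_stepFun, ← g.eq_stepFun] at key
  · rw [← integral_convSchwartz_stepFun_mul K (hm f) (hv f hf) (hm g), ← h1' f hf, ← h1' g hg]
    exact norm_integral_convSchwartz_mul_le K hA (integrable_stepFun (hm f) (hv f hf) a)
      (integrable_stepFun (hm g) (hv g hg) b)
  · rw [← integral_convSchwartz_stepFun_mul K (hm f) (hv f hf) (hm g),
      ← integral_norm_stepFun_rpow (hd f) (hm f) (hv f hf) _ two_pos,
      ← integral_norm_stepFun_rpow (hd g) (hm g) (hv g hg) _ two_pos]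
    exact h2 _ _ (integrable_stepFun (hm f) (hv f hf) a) (integrable_stepFun (hm g) (hv g hg) b)
      (hL2 f hf a) (hL2 g hg b)

theorem BBM.lpNorm_le_eLpNorm {p : ℝ≥0∞} {f : 𝓢'(ℝ, ℂ)} {g : ℝ → ℂ} (hg : MemLp g p volume)
    (hf : ∀ u : 𝓢(ℝ, ℂ), f u = ∫ x, u x * g x) : lpNorm p f ≤ eLpNorm g p volume := by
  unfold lpNorm
  exact iInf_le_of_le g (iInf_le_of_le hg (iInf_le_of_le hf le_rfl))

/-! ### Fourier multipliers from `L^{p'}` to `L^p`. -/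

section Multiplier

open scoped FourierTransform

theorem norm_Lp_ofReal {q : ℝ} (hq : 0 < q) (f : Lp ℂ (ENNReal.ofReal q) (volume : Measure ℝ)) :
    ‖f‖ = (∫ x, ‖f x‖ ^ q) ^ (1 / q) := by
  rw [← norm_toLp_ofReal hq (Lp.memLp f), Lp.toLp_coeFn]

theorem fourierMultiplierCLM_eq_convSchwartz (m f : 𝓢(ℝ, ℂ)) :
    ⇑(SchwartzMap.fourierMultiplierCLM ℂ (⇑m) f) = convSchwartz (𝓕⁻ m) f := by
  have h : SchwartzMap.fourierMultiplierCLM ℂ (⇑m) f =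
      SchwartzMap.convolution (ContinuousLinearMap.mul ℂ ℂ) f (𝓕⁻ m) := by
    change 𝓕⁻ (SchwartzMap.smulLeftCLM ℂ (⇑m) (𝓕 f)) =
      𝓕⁻ (SchwartzMap.pairing (ContinuousLinearMap.mul ℂ ℂ) (𝓕 f) (𝓕 (𝓕⁻ m)))
    congr 1
    ext x
    simp [SchwartzMap.smulLeftCLM_apply_apply m.hasTemperateGrowth, mul_comm]
  ext x
  rw [h, SchwartzMap.convolution_apply]
  rfl

theorem fourier_eq_fourierInv_neg (m : 𝓢(ℝ, ℂ)) (x : ℝ) : 𝓕 m x = 𝓕⁻ m (-x) := by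
  rw [SchwartzMap.fourierInv_coe, SchwartzMap.fourier_coe, Real.fourierInv_eq_fourier_neg, neg_neg]

/-- Plancherel, applied before and after multiplication by `m`. -/
theorem norm_toLp_two_fourierMultiplierCLM_le {m : 𝓢(ℝ, ℂ)} (hm : ∀ ξ, ‖m ξ‖ ≤ 1) (f : 𝓢(ℝ, ℂ)) :
    ‖(SchwartzMap.fourierMultiplierCLM ℂ (⇑m) f).toLp 2‖ ≤ ‖f.toLp 2‖ := by
  rw [SchwartzMap.fourierMultiplierCLM_apply, ← SchwartzMap.norm_fourier_toL2_eq,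
    FourierTransform.fourier_fourierInv_eq, ← SchwartzMap.norm_fourier_toL2_eq f]
  refine Lp.norm_le_norm_of_ae_le ?_
  filter_upwards [SchwartzMap.coeFn_toLp (SchwartzMap.smulLeftCLM ℂ (⇑m) (𝓕 f)) 2,
    SchwartzMap.coeFn_toLp (𝓕 f) 2] with x h1 h2
  rw [h1, h2, SchwartzMap.smulLeftCLM_apply_apply m.hasTemperateGrowth, smul_eq_mul, norm_mul]
  exact mul_le_of_le_one_left (norm_nonneg _) (hm x)

/-- Cauchy-Schwarz for the bilinear pairing, read off from the bound of `holder` into `L¹`. -/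
theorem norm_integral_mul_le_norm_toLp_two {f g : ℝ → ℂ} (hf : MemLp f 2) (hg : MemLp g 2) :
    ‖∫ x, f x * g x‖ ≤ ‖hf.toLp f‖ * ‖hg.toLp g‖ := by
  have hb : ‖(ContinuousLinearMap.mul ℂ ℂ).lpPairing volume 2 2 (hf.toLp f) (hg.toLp g)‖ ≤
      ‖hf.toLp f‖ * ‖hg.toLp g‖ := by
    have h1 := (ContinuousLinearMap.mul ℂ ℂ).norm_holder_apply_apply_le (r := 1) (hf.toLp f)
      (hg.toLp g)
    have h2 : ‖(ContinuousLinearMap.mul ℂ ℂ).lpPairing volume 2 2 (hf.toLp f) (hg.toLp g)‖ ≤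
        ‖(ContinuousLinearMap.mul ℂ ℂ).holder 1 (hf.toLp f) (hg.toLp g)‖ := by
      rw [ContinuousLinearMap.lpPairing_eq_integral, ← integral_congr_ae
        ((ContinuousLinearMap.mul ℂ ℂ).coeFn_holder (r := 1) (hf.toLp f) (hg.toLp g)),
        ← L1.integral_eq_integral]
      exact L1.norm_integral_le _
    refine h2.trans (h1.trans ?_)
    rw [mul_assoc]
    exact mul_le_of_le_one_left (by positivity) (ContinuousLinearMap.opNorm_mul_le ℂ ℂ)
  rw [ContinuousLinearMap.lpPairing_eq_integral] at hb
  refine le_of_eq_of_le (congrArg _ (integral_congr_ae ?_)) hb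
  filter_upwards [hf.coeFn_toLp, hg.coeFn_toLp] with x h1 h2
  simp [h1, h2]

/-- The set of Schwartz functions in `L^q` is dense for `q < ∞`. -/
theorem dense_range_toLp {q : ℝ≥0∞} [Fact (1 ≤ q)] (hq : q ≠ ⊤) :
    Dense (Set.range fun f : 𝓢(ℝ, ℂ) => f.toLp q) :=
  SchwartzMap.denseRange_toLpCLM (F := ℂ) (E := ℝ) (μ := volume) hq

/-- The `L²` bound for a convolution operator with bounded symbol. -/
theorem norm_integral_convSchwartz_mul_le_two {m : 𝓢(ℝ, ℂ)} (hm : ∀ ξ, ‖m ξ‖ ≤ 1) (f g : ℝ → ℂ)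
    (hf : Integrable f) (hg : Integrable g) (hf2 : MemLp f 2) (hg2 : MemLp g 2) :
    ‖∫ x, convSchwartz (𝓕⁻ m) f x * g x‖ ≤
      ((∫ x, ‖f x‖ ^ (2 : ℝ)) * ∫ x, ‖g x‖ ^ (2 : ℝ)) ^ (1 / 2 : ℝ) := by
  have htwo : ENNReal.ofReal 2 = 2 := by simp
  have hB := norm_integral_convSchwartz_mul_le_of_dense (P := 2) (R := 2) (K := 𝓕⁻ m) (K' := 𝓕 m)
    (fourier_eq_fourierInv_neg m)
    (fun L f hf => htwo ▸ memLp_convSchwartz L hf one_le_two) (M := 1)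
    (dense_range_toLp (q := 2) (by simp)) ?_ ?_ (f := hf2.toLp f) (g := hg2.toLp g)
    (hf.congr hf2.coeFn_toLp.symm) (hg.congr hg2.coeFn_toLp.symm)
  · rw [convSchwartz_congr _ hf2.coeFn_toLp, one_mul] at hB
    have e : ∀ h : ℝ → ℂ, ∀ hh : MemLp h 2, ‖hh.toLp h‖ = (∫ x, ‖h x‖ ^ (2 : ℝ)) ^ (1 / 2 : ℝ) := by
      intro h hh
      rw [← norm_toLp_ofReal two_pos (htwo ▸ hh), Lp.norm_toLp, Lp.norm_toLp, htwo]
    rw [Real.mul_rpow (integral_nonneg fun x => by positivity)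
      (integral_nonneg fun x => by positivity), ← e f hf2, ← e g hg2]
    refine le_of_eq_of_le (congrArg _ (integral_congr_ae ?_)) hB
    filter_upwards [hg2.coeFn_toLp] with x h1
    rw [h1]
  · rintro _ ⟨φ, rfl⟩
    exact φ.integrable.congr (φ.coeFn_toLp 2).symm
  · rintro _ ⟨φ, rfl⟩ _ ⟨γ, rfl⟩
    simp only
    rw [convSchwartz_congr _ (φ.coeFn_toLp 2), ← fourierMultiplierCLM_eq_convSchwartz, one_mul]
    have := norm_integral_mul_le_norm_toLp_two
      ((SchwartzMap.fourierMultiplierCLM ℂ (⇑m) φ).memLp 2) (γ.memLp 2)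
    refine le_of_eq_of_le (congrArg _ (integral_congr_ae ?_)) (this.trans ?_)
    · filter_upwards [γ.coeFn_toLp 2] with x h1
      rw [h1]
    · exact mul_le_mul_of_nonneg_right (norm_toLp_two_fourierMultiplierCLM_le hm φ) (norm_nonneg _)

/-- Riesz-Thorin interpolation for the bilinear form of a Fourier multiplier. -/
theorem norm_integral_convSchwartz_mul_le_Lp {m : 𝓢(ℝ, ℂ)} (hm : ∀ ξ, ‖m ξ‖ ≤ 1) {A : ℝ}
    (hA : ∀ x, ‖𝓕⁻ m x‖ ≤ A) {p r : ℝ} (hp : 2 ≤ p) (hpr : p.HolderConjugate r)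
    [Fact (1 ≤ ENNReal.ofReal r)] {f g : Lp ℂ (ENNReal.ofReal r) (volume : Measure ℝ)}
    (hf : Integrable f) (hg : Integrable g) :
    ‖∫ x, convSchwartz (𝓕⁻ m) f x * g x‖ ≤ A ^ (1 - 2 / p) * ‖f‖ * ‖g‖ := by
  have hA0 : 0 ≤ A := (norm_nonneg _).trans (hA 0)
  have hr0 : 0 < r := hpr.symm.pos
  have hrne : ENNReal.ofReal r ≠ 0 := by simpa using hr0
  have : Fact (1 ≤ ENNReal.ofReal p) := ⟨by simpa using hpr.lt.le⟩
  have : ENNReal.HolderConjugate (ENNReal.ofReal p) (ENNReal.ofReal r) := hpr.ennrealOfReal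
  have hsum : 1 / p + 1 / r = 1 := by simpa [one_div] using hpr.inv_add_inv_eq_one
  have hsi : ∀ f : Lp.simpleFunc ℂ (ENNReal.ofReal r) (volume : Measure ℝ),
      Integrable (Lp.simpleFunc.toSimpleFunc f) := fun f =>
    (SimpleFunc.memLp_iff_integrable hrne ENNReal.ofReal_ne_top).1 (Lp.simpleFunc.memLp f)
  refine norm_integral_convSchwartz_mul_le_of_dense (P := ENNReal.ofReal p) (K' := 𝓕 m)
    (fourier_eq_fourierInv_neg m) (fun L f hf => memLp_convSchwartz L hf hpr.lt.le)
    (Lp.simpleFunc.denseRange ENNReal.ofReal_ne_top) ?_ ?_ hf hg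
  · rintro _ ⟨φ, rfl⟩
    exact (hsi φ).congr (Lp.simpleFunc.toSimpleFunc_eq_toFun φ)
  · rintro _ ⟨φ, rfl⟩ _ ⟨γ, rfl⟩
    have e := norm_integral_convSchwartz_simpleFunc_le (𝓕⁻ m) hA0 hA
      (norm_integral_convSchwartz_mul_le_two hm) hp hsum hr0 _ _ (hsi φ) (hsi γ)
    have hn : ∀ φ : Lp.simpleFunc ℂ (ENNReal.ofReal r) (volume : Measure ℝ),
        ‖(φ : Lp ℂ (ENNReal.ofReal r) (volume : Measure ℝ))‖ =
          (∫ x, ‖Lp.simpleFunc.toSimpleFunc φ x‖ ^ r) ^ (1 / r) := fun φ => by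
      rw [norm_Lp_ofReal hr0]
      congr 1
      refine integral_congr_ae ?_
      filter_upwards [Lp.simpleFunc.toSimpleFunc_eq_toFun φ] with x hx
      rw [hx]
    rw [hn, hn, mul_assoc, ← Real.mul_rpow (integral_nonneg fun x => by positivity)
      (integral_nonneg fun x => by positivity),
      ← convSchwartz_congr _ (Lp.simpleFunc.toSimpleFunc_eq_toFun φ)]
    refine le_of_eq_of_le (congrArg _ (integral_congr_ae ?_)) e
    filter_upwards [Lp.simpleFunc.toSimpleFunc_eq_toFun γ] with x hx
    rw [hx]

/-- The `L^{p'} → L^p` bound of a Fourier multiplier on Schwartz functions, by interpolation between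
the bound of its kernel and the bound of its symbol. -/
theorem norm_toLp_fourierMultiplierCLM_le {m : 𝓢(ℝ, ℂ)} (hm : ∀ ξ, ‖m ξ‖ ≤ 1) {A : ℝ}
    (hA : ∀ x, ‖𝓕⁻ m x‖ ≤ A) {p r : ℝ} (hp : 2 ≤ p) (hpr : p.HolderConjugate r) (f : 𝓢(ℝ, ℂ)) :
    ‖(SchwartzMap.fourierMultiplierCLM ℂ (⇑m) f).toLp (ENNReal.ofReal p)‖ ≤
      A ^ (1 - 2 / p) * ‖f.toLp (ENNReal.ofReal r)‖ := by
  have hA0 : 0 ≤ A := (norm_nonneg _).trans (hA 0)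
  have : Fact (1 ≤ ENNReal.ofReal p) := ⟨by simpa using hpr.lt.le⟩
  have : Fact (1 ≤ ENNReal.ofReal r) := ⟨by simpa using hpr.symm.lt.le⟩
  have : ENNReal.HolderConjugate (ENNReal.ofReal p) (ENNReal.ofReal r) := hpr.ennrealOfReal
  have hfi : Integrable (f.toLp (ENNReal.ofReal r)) := f.integrable.congr (f.coeFn_toLp _).symm
  have hconv := fourierMultiplierCLM_eq_convSchwartz m f
  generalize SchwartzMap.fourierMultiplierCLM ℂ (⇑m) f = h at hconv ⊢
  -- By duality it suffices to test against `g ∈ L^r`, and by density against Schwartz `g`.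
  refine norm_toLp_le_of_forall_integral_le hpr (h.memLp _) (by positivity) fun g => ?_
  refine norm_integral_mul_le_of_dense (P := ENNReal.ofReal p) (h.memLp _)
    (dense_range_toLp ENNReal.ofReal_ne_top) ?_ g
  rintro _ ⟨γ, rfl⟩
  have hγi : Integrable (γ.toLp (ENNReal.ofReal r)) := γ.integrable.congr (γ.coeFn_toLp _).symm
  have hb := norm_integral_convSchwartz_mul_le_Lp hm hA hp hpr hfi hγi
  rw [convSchwartz_congr _ (f.coeFn_toLp _), ← hconv] at hb
  exact hb

/-- The transpose of a Fourier multiplier on Schwartz functions. -/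
theorem integral_fourierMultiplierCLM_mul (m f u : 𝓢(ℝ, ℂ)) :
    ∫ x, u x * SchwartzMap.fourierMultiplierCLM ℂ (⇑m) f x =
      ∫ x, 𝓕 (SchwartzMap.smulLeftCLM ℂ (⇑m) (𝓕⁻ u)) x * f x := by
  have h := congrArg (fun F : 𝓢'(ℝ, ℂ) => F u)
    (TemperedDistribution.fourierMultiplierCLM_toTemperedDistributionCLM_eq m.hasTemperateGrowth f)
  simpa using h.symm

/-- The `L^{p'} → L^p` bound of a Fourier multiplier on tempered distributions. -/
theorem lpNorm_fourierMultiplierCLM_le {m : 𝓢(ℝ, ℂ)} (hm : ∀ ξ, ‖m ξ‖ ≤ 1) {A : ℝ} (hA0 : 0 < A)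
    (hA : ∀ x, ‖𝓕⁻ m x‖ ≤ A) {p r : ℝ} (hp : 2 ≤ p) (hpr : p.HolderConjugate r) (f : 𝓢'(ℝ, ℂ)) :
    BBM.lpNorm (ENNReal.ofReal p) (TemperedDistribution.fourierMultiplierCLM ℂ (⇑m) f) ≤
      ENNReal.ofReal (A ^ (1 - 2 / p)) * BBM.lpNorm (ENNReal.ofReal r) f := by
  have : Fact (1 ≤ ENNReal.ofReal p) := ⟨by simpa using hpr.lt.le⟩
  have : Fact (1 ≤ ENNReal.ofReal r) := ⟨by simpa using hpr.symm.lt.le⟩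
  have : ENNReal.HolderConjugate (ENNReal.ofReal p) (ENNReal.ofReal r) := hpr.ennrealOfReal
  have : ENNReal.HolderConjugate (ENNReal.ofReal r) (ENNReal.ofReal p) := hpr.symm.ennrealOfReal
  set c := A ^ (1 - 2 / p) with hc
  have hc0 : 0 < c := by positivity
  have hcne : ENNReal.ofReal c ≠ 0 := by simpa using hc0
  let T : 𝓢(ℝ, ℂ) →ₗ[ℂ] Lp ℂ (ENNReal.ofReal p) (volume : Measure ℝ) :=
    (SchwartzMap.toLpCLM ℂ ℂ (ENNReal.ofReal p) volume).toLinearMap ∘ₗ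
      (SchwartzMap.fourierMultiplierCLM ℂ (⇑m)).toLinearMap
  let e : 𝓢(ℝ, ℂ) →ₗ[ℂ] Lp ℂ (ENNReal.ofReal r) (volume : Measure ℝ) :=
    (SchwartzMap.toLpCLM ℂ ℂ (ENNReal.ofReal r) volume).toLinearMap
  have hde : DenseRange e := dense_range_toLp ENNReal.ofReal_ne_top
  have hT : ∀ φ, ‖T φ‖ ≤ c * ‖e φ‖ := norm_toLp_fourierMultiplierCLM_le hm hA hp hpr
  let Tb := T.extendOfNorm e
  -- `m(D)` on distributions is defined by transposition, so the extension `Tb` has to be identified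
  -- with it. Both sides are continuous in `G` and agree on Schwartz functions.
  have hpair : ∀ (u : 𝓢(ℝ, ℂ)) (G : Lp ℂ (ENNReal.ofReal r) (volume : Measure ℝ)),
      ∫ x, u x * Tb G x = ∫ x, 𝓕 (SchwartzMap.smulLeftCLM ℂ (⇑m) (𝓕⁻ u)) x * G x := by
    intro u G
    have c1 : Continuous fun G : Lp ℂ (ENNReal.ofReal r) (volume : Measure ℝ) =>
        ∫ x, u x * Tb G x :=
      (continuous_integral_mul_Lp (R := ENNReal.ofReal p) (u.memLp (ENNReal.ofReal r))).comp
        Tb.continuous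
    have c2 : Continuous fun G : Lp ℂ (ENNReal.ofReal r) (volume : Measure ℝ) =>
        ∫ x, 𝓕 (SchwartzMap.smulLeftCLM ℂ (⇑m) (𝓕⁻ u)) x * G x :=
      continuous_integral_mul_Lp (R := ENNReal.ofReal r)
        ((𝓕 (SchwartzMap.smulLeftCLM ℂ (⇑m) (𝓕⁻ u))).memLp (ENNReal.ofReal p))
    refine congrFun (hde.equalizer c1 c2 ?_) G
    ext φ
    simp only [Function.comp]
    have h1 : Tb (e φ) = T φ := LinearMap.extendOfNorm_eq hde ⟨c, hT⟩ φ
    rw [h1]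
    have h2 : ∫ x, u x * T φ x = ∫ x, u x * SchwartzMap.fourierMultiplierCLM ℂ (⇑m) φ x := by
      refine integral_congr_ae ?_
      filter_upwards [SchwartzMap.coeFn_toLp (SchwartzMap.fourierMultiplierCLM ℂ (⇑m) φ)
        (ENNReal.ofReal p)] with x hx
      exact congrArg _ hx
    rw [h2, integral_fourierMultiplierCLM_mul]
    refine integral_congr_ae ?_
    filter_upwards [SchwartzMap.coeFn_toLp φ (ENNReal.ofReal r)] with x hx
    exact congrArg _ hx.symm
  have main : ∀ G : ℝ → ℂ, ∀ hG : MemLp G (ENNReal.ofReal r) volume,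
      (∀ u : 𝓢(ℝ, ℂ), f u = ∫ x, u x * G x) →
      BBM.lpNorm (ENNReal.ofReal p) (TemperedDistribution.fourierMultiplierCLM ℂ (⇑m) f) ≤
        ENNReal.ofReal c * eLpNorm G (ENNReal.ofReal r) volume := by
    intro G hG hfG
    refine (BBM.lpNorm_le_eLpNorm (Lp.memLp (Tb (hG.toLp G))) fun u => ?_).trans ?_
    · rw [TemperedDistribution.fourierMultiplierCLM_apply_apply, hfG, hpair]
      refine integral_congr_ae ?_
      filter_upwards [hG.coeFn_toLp] with x hx
      rw [hx]
    · have h1 := LinearMap.norm_extendOfNorm_apply_le hde c hT (hG.toLp G)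
      rw [← Lp.enorm_def, ← eLpNorm_congr_ae hG.coeFn_toLp, ← Lp.enorm_def, ← ofReal_norm,
        ← ofReal_norm, ← ENNReal.ofReal_mul hc0.le]
      exact ENNReal.ofReal_le_ofReal h1
  rw [BBM.lpNorm.eq_1 (ENNReal.ofReal r) f]
  -- Here `c ≠ 0` matters, hence `0 < A`: if no function represents `f`, the infimum is `∞`, and `0
  -- * ∞ = 0` would destroy the bound.
  simp only [ENNReal.mul_iInf_of_ne hcne ENNReal.ofReal_ne_top]
  exact le_iInf fun G => le_iInf fun hG => le_iInf fun hfG => main G hG hfG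

end Multiplier

/-! ### Van der Corput estimates. -/

/-- A bound for the integrals over the subintervals that avoid a `δ`-neighbourhood of a point gives
a bound for the whole integral. -/
theorem norm_integral_le_of_avoid {g : ℝ → ℂ} {a b z δ B M : ℝ} (hg : Continuous g) (hab : a ≤ b)
    (hδ : 0 ≤ δ) (hM : ∀ x, ‖g x‖ ≤ M) (hB0 : 0 ≤ B)
    (hB : ∀ a' b', a ≤ a' → a' ≤ b' → b' ≤ b → (∀ x ∈ Set.Icc a' b', δ ≤ |x - z|) →
      ‖∫ x in a'..b', g x‖ ≤ B) :
    ‖∫ x in a..b, g x‖ ≤ 2 * B + 2 * δ * M := by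
  have hi : ∀ u v, IntervalIntegrable g volume u v := fun u v => hg.intervalIntegrable u v
  have hM0 : 0 ≤ M := (norm_nonneg _).trans (hM 0)
  -- The points `z - δ` and `z + δ`, clamped to `[a, b]`. An outer piece that is not a single point
  -- really avoids the neighbourhood of `z`.
  set c := max a (min b (z - δ)) with hc
  set d := max c (min b (z + δ)) with hd
  have hac : a ≤ c := le_max_left _ _
  have hcb : c ≤ b := max_le hab (min_le_left _ _)
  have hcd : c ≤ d := le_max_left _ _
  have hdb : d ≤ b := max_le hcb (min_le_left _ _)
  rw [← intervalIntegral.integral_add_adjacent_intervals (hi a c) (hi c b),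
    ← intervalIntegral.integral_add_adjacent_intervals (hi c d) (hi d b)]
  have e1 : ‖∫ x in a..c, g x‖ ≤ B := by
    rcases eq_or_lt_of_le hac with h | h
    · rw [← h, intervalIntegral.integral_same, norm_zero]; exact hB0
    · refine hB a c le_rfl hac hcb fun x hx => ?_
      have : c = min b (z - δ) := by
        rcases max_choice a (min b (z - δ)) with h' | h'
        · rw [← hc] at h'; linarith
        · exact h'
      have h3 : c ≤ z - δ := this ▸ min_le_right _ _
      rw [abs_sub_comm]
      exact le_trans (by linarith [hx.2]) (le_abs_self _)
  have e3 : ‖∫ x in d..b, g x‖ ≤ B := by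
    rcases eq_or_lt_of_le hdb with h | h
    · rw [h, intervalIntegral.integral_same, norm_zero]; exact hB0
    · refine hB d b (hac.trans hcd) hdb le_rfl fun x hx => ?_
      have h1 : min b (z + δ) ≤ d := le_max_right _ _
      have h3 : z + δ ≤ d := by
        rcases min_choice b (z + δ) with h' | h'
        · rw [h'] at h1; linarith
        · rwa [h'] at h1
      exact le_trans (by linarith [hx.1]) (le_abs_self _)
  have e2 : ‖∫ x in c..d, g x‖ ≤ 2 * δ * M := by
    have := intervalIntegral.norm_integral_le_of_norm_le_const (a := c) (b := d) (f := g) (C := M)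
      (fun x _ => hM x)
    refine this.trans ?_
    rw [abs_of_nonneg (by linarith), mul_comm]
    refine mul_le_mul_of_nonneg_right ?_ hM0
    rcases max_choice c (min b (z + δ)) with h' | h'
    · rw [hd, h']; linarith
    · have h1 : d ≤ z + δ := by rw [hd, h']; exact min_le_right _ _
      have h2 : d ≤ b := hdb
      have h3 : min b (z - δ) ≤ c := le_max_right _ _
      rcases min_choice b (z - δ) with h4 | h4
      · rw [h4] at h3; linarith
      · rw [h4] at h3; linarith
  calc _ ≤ _ := (norm_add_le _ _).trans (add_le_add le_rfl (norm_add_le _ _))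
    _ ≤ B + (2 * δ * M + B) := add_le_add e1 (add_le_add e2 e3)
    _ = _ := by ring

/-- Van der Corput's first derivative estimate with an amplitude. -/
theorem vanDerCorput_first {ψ ψ' ψ'' w w' : ℝ → ℝ} {a b l D : ℝ} (hab : a ≤ b) (hl : 0 < l)
    (h1 : ∀ x, HasDerivAt ψ (ψ' x) x) (h2 : ∀ x, HasDerivAt ψ' (ψ'' x) x) (hc : Continuous ψ'')
    (hw : ∀ x, HasDerivAt w (w' x) x) (hwc : Continuous w') (hw1 : ∀ x, |w x| ≤ 1)
    (hD : ∀ x, |w' x| ≤ D) (hpos : (∀ x ∈ Set.Icc a b, 0 ≤ ψ'' x) ∨ ∀ x ∈ Set.Icc a b, ψ'' x ≤ 0)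
    (hlow : ∀ x ∈ Set.Icc a b, l ≤ |ψ' x|) :
    ‖∫ x in a..b, Complex.exp (Complex.I * ψ x) * w x‖ ≤ (4 + D * (b - a)) / l := by
  have hψc : Continuous ψ := continuous_iff_continuousAt.2 fun x => (h1 x).continuousAt
  have hψ'c : Continuous ψ' := continuous_iff_continuousAt.2 fun x => (h2 x).continuousAt
  have hwc0 : Continuous w := continuous_iff_continuousAt.2 fun x => (hw x).continuousAt
  have hu : Set.uIcc a b = Set.Icc a b := Set.uIcc_of_le hab
  have hne : ∀ x ∈ Set.Icc a b, ψ' x ≠ 0 := fun x hx h0 => by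
    have := hlow x hx; rw [h0, abs_zero] at this; linarith
  have hinv : ∀ x ∈ Set.Icc a b, |(ψ' x)⁻¹| ≤ l⁻¹ := fun x hx => by
    rw [abs_inv]; exact inv_anti₀ hl (hlow x hx)
  -- integrate by parts `w / ψ'` against `(exp (i ψ))'`
  let u : ℝ → ℝ := fun x => w x * (ψ' x)⁻¹
  let u' : ℝ → ℝ := fun x => w' x * (ψ' x)⁻¹ + w x * (-ψ'' x / ψ' x ^ 2)
  have hu' : ∀ x ∈ Set.Icc a b, HasDerivAt u (u' x) x := fun x hx =>
    (hw x).mul ((h2 x).inv (hne x hx))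
  let v : ℝ → ℂ := fun x => Complex.exp (Complex.I * ψ x)
  have hv : ∀ x, HasDerivAt v (v x * (Complex.I * ψ' x)) x := fun x =>
    ((h1 x).ofReal_comp.const_mul Complex.I).cexp
  have hvn : ∀ x, ‖v x‖ = 1 := fun x => by
    simp only [v, mul_comm Complex.I]; exact Complex.norm_exp_ofReal_mul_I _
  have hvc : Continuous v := by fun_prop
  have hcinv : ContinuousOn (fun x => (ψ' x)⁻¹) (Set.Icc a b) := hψ'c.continuousOn.inv₀ hne
  have hcq : ContinuousOn (fun x => -ψ'' x / ψ' x ^ 2) (Set.Icc a b) :=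
    hc.neg.continuousOn.div (hψ'c.pow 2).continuousOn fun x hx => pow_ne_zero _ (hne x hx)
  have hu'c : ContinuousOn u' (Set.Icc a b) :=
    (hwc.continuousOn.mul hcinv).add (hwc0.continuousOn.mul hcq)
  have hibp := intervalIntegral.integral_mul_deriv_eq_deriv_mul (a := a) (b := b)
    (u := fun x => (u x : ℂ)) (u' := fun x => (u' x : ℂ)) (v := v)
    (v' := fun x => v x * (Complex.I * ψ' x))
    (fun x hx => (hu' x (hu ▸ hx)).ofReal_comp) (fun x _ => hv x)
    (ContinuousOn.intervalIntegrable (by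
      rw [hu]; exact Complex.continuous_ofReal.comp_continuousOn hu'c))
    ((by fun_prop : Continuous fun x => v x * (Complex.I * ψ' x)).intervalIntegrable _ _)
  have hint : ∫ x in a..b, (u x : ℂ) * (v x * (Complex.I * ψ' x)) =
      Complex.I * ∫ x in a..b, Complex.exp (Complex.I * ψ x) * w x := by
    rw [← intervalIntegral.integral_const_mul]
    refine intervalIntegral.integral_congr fun x hx => ?_
    have hx' : (ψ' x : ℂ) ≠ 0 := by exact_mod_cast hne x (hu ▸ hx)
    simp only [u, v]
    push_cast
    field_simp
  rw [hint] at hibp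
  have hn : ‖∫ x in a..b, Complex.exp (Complex.I * ψ x) * w x‖ =
      ‖Complex.I * ∫ x in a..b, Complex.exp (Complex.I * ψ x) * w x‖ := by simp
  have hub : ∀ x ∈ Set.Icc a b, ‖(u x : ℂ) * v x‖ ≤ l⁻¹ := fun x hx => by
    rw [norm_mul, hvn, mul_one, Complex.norm_real, Real.norm_eq_abs, abs_mul]
    exact (mul_le_of_le_one_left (abs_nonneg _) (hw1 x)).trans (hinv x hx)
  -- As `ψ''` keeps its sign, this variation of `1 / ψ'` telescopes to a difference of endpoint
  -- values. With the two boundary terms it accounts for the constant `4`.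
  have hvar : ∫ x in a..b, |ψ'' x| / ψ' x ^ 2 ≤ 2 * l⁻¹ := by
    have hFTC := intervalIntegral.integral_eq_sub_of_hasDerivAt (a := a) (b := b)
      (f := fun x => (ψ' x)⁻¹) (f' := fun x => -ψ'' x / ψ' x ^ 2)
      (fun x hx => (h2 x).inv (hne x (hu ▸ hx)))
      (ContinuousOn.intervalIntegrable (by rw [hu]; exact hcq))
    have ha' := abs_le.1 (hinv a ⟨le_rfl, hab⟩)
    have hb' := abs_le.1 (hinv b ⟨hab, le_rfl⟩)
    rcases hpos with hpos | hpos
    · have : ∫ x in a..b, |ψ'' x| / ψ' x ^ 2 = -∫ x in a..b, -ψ'' x / ψ' x ^ 2 := by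
        rw [← intervalIntegral.integral_neg]
        refine intervalIntegral.integral_congr fun x hx => ?_
        rw [abs_of_nonneg (hpos x (hu ▸ hx)), neg_div, neg_neg]
      rw [this, hFTC]; linarith
    · have : ∫ x in a..b, |ψ'' x| / ψ' x ^ 2 = ∫ x in a..b, -ψ'' x / ψ' x ^ 2 := by
        refine intervalIntegral.integral_congr fun x hx => ?_
        rw [abs_of_nonpos (hpos x (hu ▸ hx))]
      rw [this, hFTC]; linarith
  have hcq' : ContinuousOn (fun x => |ψ'' x| / ψ' x ^ 2) (Set.Icc a b) :=
    hc.abs.continuousOn.div (hψ'c.pow 2).continuousOn fun x hx => pow_ne_zero _ (hne x hx)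
  have hrem : ‖∫ x in a..b, (u' x : ℂ) * v x‖ ≤ D * (b - a) * l⁻¹ + 2 * l⁻¹ := by
    calc ‖∫ x in a..b, (u' x : ℂ) * v x‖
        ≤ ∫ x in a..b, (D * l⁻¹ + |ψ'' x| / ψ' x ^ 2) := by
          refine intervalIntegral.norm_integral_le_of_norm_le hab
            (Filter.Eventually.of_forall fun x hx => ?_) ?_
          · have hx' : x ∈ Set.Icc a b := ⟨hx.1.le, hx.2⟩
            rw [norm_mul, hvn, mul_one, Complex.norm_real, Real.norm_eq_abs]
            refine (abs_add_le _ _).trans (add_le_add ?_ ?_)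
            · rw [abs_mul]
              exact mul_le_mul (hD x) (hinv x hx') (abs_nonneg _) ((abs_nonneg _).trans (hD x))
            · rw [abs_mul, abs_div, abs_neg, abs_of_nonneg (sq_nonneg (ψ' x))]
              exact mul_le_of_le_one_left (by positivity) (hw1 x)
          · refine ContinuousOn.intervalIntegrable ?_
            rw [hu]
            exact continuousOn_const.add hcq'
      _ = D * (b - a) * l⁻¹ + ∫ x in a..b, |ψ'' x| / ψ' x ^ 2 := by
          rw [intervalIntegral.integral_add (by simp)
            (ContinuousOn.intervalIntegrable (by rw [hu]; exact hcq'))]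
          simp
          ring
      _ ≤ _ := by linarith
  rw [hn, hibp]
  calc _ ≤ l⁻¹ + l⁻¹ + (D * (b - a) * l⁻¹ + 2 * l⁻¹) := by
        refine (norm_sub_le _ _).trans (add_le_add ((norm_sub_le _ _).trans (add_le_add ?_ ?_)) hrem)
        · exact hub b ⟨hab, le_rfl⟩
        · exact hub a ⟨le_rfl, hab⟩
    _ = _ := by field_simp; ring

/-- A function whose derivative is at least `L` on an interval grows away from a point of it at
least at the rate `L`. -/
theorem exists_mul_abs_sub_le_abs {f f' : ℝ → ℝ} {a b L : ℝ} (hab : a ≤ b)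
    (hf : ∀ x, HasDerivAt f (f' x) x) (hlow : ∀ x ∈ Set.Icc a b, L ≤ f' x) :
    ∃ z, ∀ x ∈ Set.Icc a b, L * |x - z| ≤ |f x| := by
  have hfc : Continuous f := continuous_iff_continuousAt.2 fun x => (hf x).continuousAt
  have mvt : ∀ x y, a ≤ x → x ≤ y → y ≤ b → L * (y - x) ≤ f y - f x := fun x y hx hxy hy => by
    refine (convex_Icc a b).mul_sub_le_image_sub_of_le_deriv hfc.continuousOn
      (fun x _ => (hf x).differentiableAt.differentiableWithinAt) (fun x hx => ?_)
      x ⟨hx, hxy.trans hy⟩ y ⟨hx.trans hxy, hy⟩ hxy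
    rw [(hf x).deriv]
    exact hlow x (interior_subset hx)
  -- The point `z` is `a` if `f` starts nonnegative, `b` if it ends nonpositive, and otherwise a
  -- zero of `f`.
  rcases le_or_gt 0 (f a) with h0 | h0
  · refine ⟨a, fun x hx => ?_⟩
    rw [abs_of_nonneg (by linarith [hx.1])]
    exact le_trans (by linarith [mvt a x le_rfl hx.1 hx.2]) (le_abs_self _)
  rcases le_or_gt (f b) 0 with h1 | h1
  · refine ⟨b, fun x hx => ?_⟩
    rw [abs_sub_comm, abs_of_nonneg (by linarith [hx.2])]
    exact le_trans (by linarith [mvt x b hx.1 hx.2 le_rfl]) (neg_le_abs _)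
  obtain ⟨z, hz, hz0⟩ := intermediate_value_Icc hab hfc.continuousOn ⟨h0.le, h1.le⟩
  refine ⟨z, fun x hx => ?_⟩
  rcases le_total z x with h | h
  · rw [abs_of_nonneg (by linarith)]
    exact le_trans (by linarith [mvt z x hz.1 h hx.2]) (le_abs_self _)
  · rw [abs_sub_comm, abs_of_nonneg (by linarith)]
    exact le_trans (by linarith [mvt x z hx.1 h hz.2]) (neg_le_abs _)

/-- A continuous function that is bounded away from zero on an interval has constant sign there. -/
theorem le_or_le_neg_of_le_abs {f : ℝ → ℝ} {a b L : ℝ} (hL : 0 < L)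
    (hf : ContinuousOn f (Set.Icc a b)) (h : ∀ x ∈ Set.Icc a b, L ≤ |f x|) :
    (∀ x ∈ Set.Icc a b, L ≤ f x) ∨ ∀ x ∈ Set.Icc a b, f x ≤ -L := by
  by_contra! hcon
  obtain ⟨⟨x, hx, hx'⟩, y, hy, hy'⟩ := hcon
  have hxn : f x ≤ 0 := by
    rcases le_abs.1 (h x hx) with h | h <;> linarith
  have hyp : 0 ≤ f y := by
    rcases le_abs.1 (h y hy) with h | h <;> linarith
  obtain ⟨z, hz, hz0⟩ := isPreconnected_Icc.intermediate_value hx hy hf ⟨hxn, hyp⟩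
  have := h z hz
  rw [hz0, abs_zero] at this
  linarith

/-- Van der Corput's second derivative estimate with an amplitude, on intervals of length at most
`2`. -/
theorem vanDerCorput_second {ψ ψ' ψ'' w w' : ℝ → ℝ} {a b L D : ℝ} (hab : a ≤ b) (hab2 : b - a ≤ 2)
    (hL : 0 < L)
    (h1 : ∀ x, HasDerivAt ψ (ψ' x) x) (h2 : ∀ x, HasDerivAt ψ' (ψ'' x) x) (hc : Continuous ψ'')
    (hw : ∀ x, HasDerivAt w (w' x) x) (hwc : Continuous w') (hw1 : ∀ x, |w x| ≤ 1)
    (hD : ∀ x, |w' x| ≤ D) (habs : ∀ x ∈ Set.Icc a b, L ≤ |ψ'' x|) :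
    ‖∫ x in a..b, Complex.exp (Complex.I * ψ x) * w x‖ ≤ (10 + 4 * D) / √L := by
  have hlow := le_or_le_neg_of_le_abs hL hc.continuousOn habs
  have hD0 : 0 ≤ D := (abs_nonneg _).trans (hD 0)
  have hψc : Continuous ψ := continuous_iff_continuousAt.2 fun x => (h1 x).continuousAt
  have hwc0 : Continuous w := continuous_iff_continuousAt.2 fun x => (hw x).continuousAt
  have hs : 0 < √L := Real.sqrt_pos.2 hL
  obtain ⟨z, hz⟩ : ∃ z, ∀ x ∈ Set.Icc a b, L * |x - z| ≤ |ψ' x| := by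
    rcases hlow with h | h
    · exact exists_mul_abs_sub_le_abs hab h2 h
    · obtain ⟨z, hz⟩ := exists_mul_abs_sub_le_abs (L := L) (f := fun x => -ψ' x) (f' := fun x => -ψ'' x)
        hab (fun x => (h2 x).neg) (fun x hx => by linarith [h x hx])
      exact ⟨z, fun x hx => by simpa using hz x hx⟩
  -- At distance `1/√L` from `z`, `|ψ'| ≥ √L`, so the first derivative estimate applies. The
  -- constant is `2(4 + 2D) + 2 = 10 + 4D`.
  have := norm_integral_le_of_avoid (g := fun x => Complex.exp (Complex.I * ψ x) * w x)
    (z := z) (δ := (√L)⁻¹) (B := (4 + D * 2) / √L) (M := 1) (by fun_prop) hab (by positivity)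
    (fun x => ?_) (by positivity) (fun a' b' ha hab' hb hδ => ?_)
  · refine this.trans (le_of_eq ?_)
    field_simp; ring
  · rw [norm_mul, mul_comm Complex.I, Complex.norm_exp_ofReal_mul_I, one_mul, Complex.norm_real]
    exact hw1 x
  · have hsub : Set.Icc a' b' ⊆ Set.Icc a b := Set.Icc_subset_Icc ha hb
    refine (vanDerCorput_first hab' hs h1 h2 hc hw hwc hw1 hD ?_ fun x hx => ?_).trans ?_
    · rcases hlow with h | h
      · exact Or.inl fun x hx => hL.le.trans (h x (hsub hx))
      · exact Or.inr fun x hx => (h x (hsub hx)).trans (by linarith)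
    · refine le_trans ?_ (hz x (hsub hx))
      calc √L = L * (√L)⁻¹ := by
            rw [eq_mul_inv_iff_mul_eq₀ hs.ne', Real.mul_self_sqrt hL.le]
        _ ≤ _ := by gcongr; exact hδ x hx
    · gcongr
      linarith

/-! ### The dispersion relation and its oscillatory integrals. -/

namespace BBM

/-- The first derivative of `phi`. -/
noncomputable def phiDeriv (ξ : ℝ) : ℝ := (1 - ξ ^ 2) / (1 + ξ ^ 2) ^ 2

/-- The second derivative of `phi`. -/
noncomputable def phiDeriv₂ (ξ : ℝ) : ℝ := 2 * (ξ * (ξ ^ 2 - 3)) / (1 + ξ ^ 2) ^ 3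

theorem hasDerivAt_phi (ξ : ℝ) : HasDerivAt phi (phiDeriv ξ) ξ := by
  have h : (1 + ξ ^ 2) ≠ 0 := by positivity
  have := (hasDerivAt_id ξ).fun_div ((hasDerivAt_pow 2 ξ).const_add 1) h
  refine this.congr_deriv ?_
  simp only [phiDeriv, id]
  field_simp
  push_cast
  ring

theorem hasDerivAt_phiDeriv (ξ : ℝ) : HasDerivAt phiDeriv (phiDeriv₂ ξ) ξ := by
  have h : (1 + ξ ^ 2) ^ 2 ≠ 0 := by positivity
  have := ((hasDerivAt_pow 2 ξ).const_sub 1).fun_div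
    (((hasDerivAt_pow 2 ξ).const_add 1).fun_pow 2) h
  refine this.congr_deriv ?_
  simp only [phiDeriv₂]
  field_simp
  push_cast
  ring

theorem continuous_phiDeriv₂ : Continuous phiDeriv₂ := by
  unfold phiDeriv₂
  exact Continuous.div (by fun_prop) (by fun_prop) fun ξ => by positivity

theorem le_abs_phiDeriv₂ {ξ δ N : ℝ} (hN : |ξ| ≤ N) (hN1 : 1 ≤ N) (hδ : 0 ≤ δ) (h0 : δ ≤ |ξ - 0|)
    (h1 : δ ≤ |ξ - √3|) (h2 : δ ≤ |ξ - -√3|) : δ / (2 * N ^ 4) ≤ |phiDeriv₂ ξ| := by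
  have hs : √3 * √3 = 3 := Real.mul_self_sqrt (by norm_num)
  have hs0 : 1 ≤ √3 := Real.one_le_sqrt.2 (by norm_num)
  have key : δ * (1 + ξ ^ 2) ≤ |ξ * (ξ ^ 2 - 3)| := by
    wlog hξ : 0 ≤ ξ generalizing ξ with H
    · have := H (ξ := -ξ) (by simpa using hN) (by simpa using h0)
        (by rw [← abs_neg]; ring_nf at h2 ⊢; exact h2)
        (by rw [← abs_neg]; ring_nf at h1 ⊢; exact h1) (by linarith)
      rw [neg_sq, neg_mul, abs_neg] at this
      exact this
    rw [sub_zero, abs_of_nonneg hξ] at h0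
    rw [abs_mul, abs_of_nonneg hξ]
    -- For `ξ ≤ 1` the factor `ξ ≥ δ` is the small one and `3 - ξ² ≥ 1 + ξ²`. For `ξ ≥ 1` it is `|ξ
    -- - √3| ≥ δ`, and `ξ(ξ + √3) ≥ 1 + ξ²`.
    rcases le_total ξ 1 with h | h
    · rw [abs_of_nonpos (by nlinarith)]
      have : 1 + ξ ^ 2 ≤ -(ξ ^ 2 - 3) := by nlinarith
      exact mul_le_mul h0 this (by positivity) hξ
    · have : ξ ^ 2 - 3 = (ξ - √3) * (ξ + √3) := by linear_combination hs
      rw [this, abs_mul, abs_of_nonneg (show 0 ≤ ξ + √3 by positivity)]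
      calc δ * (1 + ξ ^ 2) ≤ |ξ - √3| * (ξ * (ξ + √3)) :=
            mul_le_mul h1 (by nlinarith) (by positivity) (abs_nonneg _)
        _ = _ := by ring
  have hN2 : 1 + ξ ^ 2 ≤ 2 * N ^ 2 := by
    have := sq_le_sq' (neg_le_of_abs_le hN) (le_of_abs_le hN)
    nlinarith
  rw [phiDeriv₂, abs_div, abs_mul, abs_of_pos (show (0 : ℝ) < 2 by norm_num),
    abs_of_pos (show 0 < (1 + ξ ^ 2) ^ 3 by positivity), div_le_div_iff₀ (by positivity)
      (by positivity)]
  calc δ * (1 + ξ ^ 2) ^ 3 = δ * (1 + ξ ^ 2) * (1 + ξ ^ 2) ^ 2 := by ring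
    _ ≤ |ξ * (ξ ^ 2 - 3)| * (2 * N ^ 2) ^ 2 := by gcongr
    _ = _ := by ring

/-- Decay of the oscillatory integrals of the BBM group over a unit frequency window: the cube of
the bound is proportional to `(1 + |κ|)⁴ / |t|`. -/
theorem norm_oscillatory_le {w w' : ℝ → ℝ} {κ D t δ : ℝ} (x : ℝ)
    (hw : ∀ x, HasDerivAt w (w' x) x) (hwc : Continuous w') (hw1 : ∀ x, |w x| ≤ 1)
    (hD : ∀ x, |w' x| ≤ D) (hδ : 0 < δ) (htδ : |t| * δ ^ 3 = (2 + |κ|) ^ 4) :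
    ‖∫ ξ in (κ - 1)..(κ + 1), Complex.exp (Complex.I * (x * ξ - t * phi ξ : ℝ)) * w ξ‖
      ≤ (174 + 64 * D) * δ := by
  have hD0 : 0 ≤ D := (abs_nonneg _).trans (hD 0)
  have hwc0 : Continuous w := continuous_iff_continuousAt.2 fun x => (hw x).continuousAt
  have hφc : Continuous phi := continuous_iff_continuousAt.2 fun x => (hasDerivAt_phi x).continuousAt
  set g : ℝ → ℂ := fun ξ => Complex.exp (Complex.I * (x * ξ - t * phi ξ : ℝ)) * w ξ with hg
  have hgc : Continuous g := by fun_prop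
  have hg1 : ∀ ξ, ‖g ξ‖ ≤ 1 := fun ξ => by
    rw [hg]
    simp only
    rw [norm_mul, mul_comm Complex.I, Complex.norm_exp_ofReal_mul_I, one_mul, Complex.norm_real]
    exact hw1 ξ
  have ht : |t| = (2 + |κ|) ^ 4 / δ ^ 3 := by field_simp; exact htδ
  set B := (10 + 4 * D) * (2 * δ) with hB
  have hB0 : 0 ≤ B := by positivity
  have good : ∀ a b, κ - 1 ≤ a → a ≤ b → b ≤ κ + 1 → (∀ ξ ∈ Set.Icc a b, δ ≤ |ξ - 0|) →
      (∀ ξ ∈ Set.Icc a b, δ ≤ |ξ - √3|) → (∀ ξ ∈ Set.Icc a b, δ ≤ |ξ - -√3|) →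
      ‖∫ ξ in a..b, g ξ‖ ≤ B := by
    intro a b ha hab hb h0 h1 h2
    -- By the choice of `δ`, `|t|` times the lower bound `δ / (2(2 + |κ|)⁴)` of `|φ''|` is `1 /
    -- (2δ²)`, so van der Corput yields a multiple of `δ`.
    have hL : 0 < (2 * δ ^ 2)⁻¹ := by positivity
    refine (vanDerCorput_second (ψ := fun ξ => x * ξ - t * phi ξ)
      (ψ' := fun ξ => x - t * phiDeriv ξ) (ψ'' := fun ξ => -(t * phiDeriv₂ ξ)) hab (by linarith) hL
      (fun ξ => ?_) (fun ξ => ?_) ?_ hw hwc hw1 hD fun ξ hξ => ?_).trans ?_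
    · have := ((hasDerivAt_id ξ).const_mul x).sub ((hasDerivAt_phi ξ).const_mul t)
      rw [mul_one] at this
      exact this
    · exact ((hasDerivAt_phiDeriv ξ).const_mul t).const_sub x
    · exact (continuous_const.mul continuous_phiDeriv₂).neg
    · have hξN : |ξ| ≤ 2 + |κ| := by
        rw [abs_le]
        constructor
        · linarith [hξ.1, neg_abs_le κ]
        · linarith [hξ.2, le_abs_self κ]
      have := le_abs_phiDeriv₂ hξN (by linarith [abs_nonneg κ]) hδ.le (h0 ξ hξ) (h1 ξ hξ) (h2 ξ hξ)
      rw [abs_neg, abs_mul, ht]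
      calc (2 * δ ^ 2)⁻¹ = (2 + |κ|) ^ 4 / δ ^ 3 * (δ / (2 * (2 + |κ|) ^ 4)) := by
            have : 0 < 2 + |κ| := by positivity
            field_simp
        _ ≤ _ := by gcongr
    · rw [hB, div_eq_mul_inv]
      refine mul_le_mul_of_nonneg_left ?_ (by positivity)
      rw [Real.sqrt_inv, inv_inv, Real.sqrt_le_left (by positivity)]
      nlinarith
  -- The zeros `-√3`, `√3`, `0` are cut out one at a time, each step turning a bound `X` into `2X +
  -- 2δ`. In total this is `8B + 14δ = (174 + 64D)δ`.
  have s1 : ∀ a b, κ - 1 ≤ a → a ≤ b → b ≤ κ + 1 → (∀ ξ ∈ Set.Icc a b, δ ≤ |ξ - 0|) →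
      (∀ ξ ∈ Set.Icc a b, δ ≤ |ξ - √3|) → ‖∫ ξ in a..b, g ξ‖ ≤ 2 * B + 2 * δ * 1 :=
    fun a b ha hab hb h0 h1 => norm_integral_le_of_avoid (z := -√3) hgc hab hδ.le hg1 hB0
      fun a' b' ha' hab' hb' h2 => good a' b' (ha.trans ha') hab' (hb'.trans hb)
        (fun ξ hξ => h0 ξ (Set.Icc_subset_Icc ha' hb' hξ))
        (fun ξ hξ => h1 ξ (Set.Icc_subset_Icc ha' hb' hξ)) h2
  have s2 : ∀ a b, κ - 1 ≤ a → a ≤ b → b ≤ κ + 1 → (∀ ξ ∈ Set.Icc a b, δ ≤ |ξ - 0|) →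
      ‖∫ ξ in a..b, g ξ‖ ≤ 2 * (2 * B + 2 * δ * 1) + 2 * δ * 1 :=
    fun a b ha hab hb h0 => norm_integral_le_of_avoid (z := √3) hgc hab hδ.le hg1 (by positivity)
      fun a' b' ha' hab' hb' h1 => s1 a' b' (ha.trans ha') hab' (hb'.trans hb)
        (fun ξ hξ => h0 ξ (Set.Icc_subset_Icc ha' hb' hξ)) h1
  have s3 := norm_integral_le_of_avoid (z := 0) (a := κ - 1) (b := κ + 1) hgc (by linarith) hδ.le
    hg1 (by positivity) s2
  refine s3.trans (le_of_eq ?_)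
  rw [hB]; ring

end BBM

/-! ### The partition of unity `σ_k`. -/

namespace BBM

section Cutoff

variable {ρ : ℝ → ℝ}

theorem IsCutoff.support_subset (hρ : IsCutoff ρ) {n : ℤ} {ξ : ℝ} (hξ : |ξ - n| < 1) (l : ℤ)
    (hl : l ∉ Finset.Icc (n - 1) (n + 1)) : ρ (ξ - l) = 0 := by
  refine hρ.eq_zero _ ?_
  by_contra! h
  refine hl (Finset.mem_Icc.2 ?_)
  rw [abs_lt] at h hξ
  have h1 : (l : ℝ) < n + 2 := by linarith
  have h2 : (n : ℝ) < l + 2 := by linarith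
  have h1' : l < n + 2 := by exact_mod_cast h1
  have h2' : n < l + 2 := by exact_mod_cast h2
  constructor <;> linarith

theorem IsCutoff.tsum_eq_sum (hρ : IsCutoff ρ) {n : ℤ} {ξ : ℝ} (hξ : |ξ - n| < 1) :
    ∑' l : ℤ, ρ (ξ - l) = ∑ l ∈ Finset.Icc (n - 1) (n + 1), ρ (ξ - l) :=
  _root_.tsum_eq_sum fun l hl => hρ.support_subset hξ l hl

theorem abs_sub_round_lt_one (ξ : ℝ) : |ξ - round ξ| < 1 :=
  (abs_sub_round ξ).trans_lt (by norm_num)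

theorem IsCutoff.one_le_tsum (hρ : IsCutoff ρ) (ξ : ℝ) : 1 ≤ ∑' l : ℤ, ρ (ξ - l) := by
  rw [hρ.tsum_eq_sum (abs_sub_round_lt_one ξ), ← hρ.eq_one _ (abs_sub_round ξ)]
  exact Finset.single_le_sum (f := fun l : ℤ => ρ (ξ - l)) (fun l _ => (hρ.mem_Icc _).1)
    (Finset.mem_Icc.2 ⟨by linarith, by linarith⟩)

/-- Smoothness is local, and near `ξ₀` only the three integers around `round ξ₀` contribute. -/
theorem IsCutoff.contDiff_tsum (hρ : IsCutoff ρ) : ContDiff ℝ ∞ fun ξ => ∑' l : ℤ, ρ (ξ - l) := by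
  refine contDiff_iff_contDiffAt.2 fun ξ₀ => ?_
  have h : ContDiff ℝ ∞ fun ξ => ∑ l ∈ Finset.Icc (round ξ₀ - 1) (round ξ₀ + 1), ρ (ξ - l) :=
    ContDiff.sum fun l _ => hρ.smooth.comp (contDiff_id.sub contDiff_const)
  refine h.contDiffAt.congr_of_eventuallyEq ?_
  have hopen : IsOpen {ξ : ℝ | |ξ - round ξ₀| < 1} :=
    isOpen_lt (by fun_prop) continuous_const
  filter_upwards [hopen.mem_nhds (abs_sub_round_lt_one ξ₀)] with ξ hξ
  exact hρ.tsum_eq_sum hξ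

theorem IsCutoff.contDiff_sigma (hρ : IsCutoff ρ) (k : ℤ) : ContDiff ℝ ∞ (sigma ρ k) := by
  unfold sigma
  exact (hρ.smooth.comp (contDiff_id.sub contDiff_const)).mul
    (hρ.contDiff_tsum.inv fun ξ => by linarith [hρ.one_le_tsum ξ])

theorem IsCutoff.sigma_eq_zero (hρ : IsCutoff ρ) (k : ℤ) {ξ : ℝ} (h : 1 ≤ |ξ - k|) :
    sigma ρ k ξ = 0 := by
  rw [sigma, hρ.eq_zero _ h, zero_mul]

theorem IsCutoff.abs_sigma_le_one (hρ : IsCutoff ρ) (k : ℤ) (ξ : ℝ) : |sigma ρ k ξ| ≤ 1 := by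
  have h1 := hρ.mem_Icc (ξ - k)
  have h2 := hρ.one_le_tsum ξ
  rw [sigma, abs_mul, abs_of_nonneg h1.1, abs_of_nonneg (by positivity)]
  exact mul_le_one₀ h1.2 (by positivity) (inv_le_one_of_one_le₀ h2)

theorem sigma_eq_sigma_zero_sub (ρ : ℝ → ℝ) (k : ℤ) (ξ : ℝ) :
    sigma ρ k ξ = sigma ρ 0 (ξ - k) := by
  unfold sigma
  rw [← (Equiv.addRight k).tsum_eq (fun l : ℤ => ρ (ξ - l))]
  simp only [Equiv.coe_addRight, Int.cast_add, Int.cast_zero, sub_zero]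
  congr 3
  ext l
  congr 1
  ring

/-- On the support of `σ_k` all other `σ_l` vanish, so the three neighbours already sum to `1`
there. -/
theorem IsCutoff.sigma_mul_sum (hρ : IsCutoff ρ) (k : ℤ) (ξ : ℝ) :
    sigma ρ k ξ * ∑ l ∈ Finset.Icc (k - 1) (k + 1), sigma ρ l ξ = sigma ρ k ξ := by
  rcases le_or_gt 1 |ξ - k| with h | h
  · rw [hρ.sigma_eq_zero k h, zero_mul]
  · have : ∑ l ∈ Finset.Icc (k - 1) (k + 1), sigma ρ l ξ = 1 := by
      simp only [sigma]
      rw [← Finset.sum_mul, ← hρ.tsum_eq_sum h]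
      exact mul_inv_cancel₀ (by linarith [hρ.one_le_tsum ξ])
    rw [this, mul_one]

theorem IsCutoff.hasCompactSupport_sigma (hρ : IsCutoff ρ) (k : ℤ) :
    HasCompactSupport (sigma ρ k) := by
  refine HasCompactSupport.intro (isCompact_Icc (a := (k : ℝ) - 1) (b := k + 1)) fun ξ hξ => ?_
  refine hρ.sigma_eq_zero k ?_
  by_contra! h
  rw [abs_lt] at h
  exact hξ ⟨by linarith, by linarith⟩

/-- The derivatives of the `σ_k` are bounded uniformly in `k`. -/
theorem IsCutoff.exists_abs_deriv_sigma_le (hρ : IsCutoff ρ) :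
    ∃ D : ℝ, ∀ (k : ℤ) (ξ : ℝ), |deriv (sigma ρ k) ξ| ≤ D := by
  obtain ⟨D, hD⟩ := (hρ.hasCompactSupport_sigma 0).deriv.exists_bound_of_continuous
    ((hρ.contDiff_sigma 0).continuous_deriv (by simp))
  refine ⟨D, fun k ξ => ?_⟩
  have : sigma ρ k = fun ξ => sigma ρ 0 (ξ - k) := funext (sigma_eq_sigma_zero_sub ρ k)
  rw [this, deriv_comp_sub_const]
  exact hD _

end Cutoff

/-! ### Temperate growth of the symbols, needed to compose multipliers. -/

section Growth

theorem hasTemperateGrowth_exp_neg_I_mul :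
    Function.HasTemperateGrowth fun x : ℝ => Complex.exp (-(Complex.I * x)) := by
  have hd : ∀ n : ℕ, iteratedDeriv n (fun x : ℝ => Complex.exp (-(Complex.I * x))) =
      fun x : ℝ => (-Complex.I) ^ n * Complex.exp (-(Complex.I * x)) := by
    intro n
    induction n with
    | zero => simp
    | succ n ih =>
      rw [iteratedDeriv_succ, ih]
      ext x
      have h : HasDerivAt (fun x : ℝ => Complex.exp (-(Complex.I * x)))
          (Complex.exp (-(Complex.I * x)) * (-(Complex.I * 1))) x :=
        ((Complex.ofRealCLM.hasDerivAt (x := x)).const_mul Complex.I).neg.cexp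
      rw [(h.const_mul _).deriv]
      ring
  refine ⟨(contDiff_const.mul Complex.ofRealCLM.contDiff).neg.cexp, fun n => ⟨0, 1, fun x => ?_⟩⟩
  rw [norm_iteratedFDeriv_eq_norm_iteratedDeriv, hd]
  have : ‖Complex.exp (-(Complex.I * x))‖ = 1 := by
    rw [← mul_neg, mul_comm, ← Complex.ofReal_neg, Complex.norm_exp_ofReal_mul_I]
  simp [this]

theorem hasTemperateGrowth_phi : Function.HasTemperateGrowth phi := by
  have h : phi = fun ξ : ℝ => ξ * (1 + ‖ξ‖ ^ 2) ^ (-1 : ℝ) := by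
    ext ξ
    simp [phi, Real.rpow_neg_one, div_eq_mul_inv]
  rw [h]
  exact Function.HasTemperateGrowth.id'.mul (Function.hasTemperateGrowth_one_add_norm_sq_rpow ℝ (-1))

/-- The symbol of the group, as a function of the frequency of Mathlib's Fourier transform. -/
theorem hasTemperateGrowth_groupSymbol (t : ℝ) : Function.HasTemperateGrowth
    fun ξ : ℝ => Complex.exp (-(Complex.I * (t * phi (2 * Real.pi * ξ) : ℝ))) := by
  have h1 : Function.HasTemperateGrowth fun ξ : ℝ => 2 * Real.pi * ξ := by fun_prop
  have h2 : Function.HasTemperateGrowth fun ξ : ℝ => t * phi (2 * Real.pi * ξ) :=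
    (Function.HasTemperateGrowth.const t).mul (hasTemperateGrowth_phi.comp h1)
  exact hasTemperateGrowth_exp_neg_I_mul.comp h2

end Growth

end BBM

/-! ### The blocks `□_k S(t)` and their kernels. -/

namespace BBM

section Block

open scoped FourierTransform

variable {ρ : ℝ → ℝ}

theorem IsCutoff.hasTemperateGrowth_sigma (hρ : IsCutoff ρ) (k : ℤ) :
    Function.HasTemperateGrowth fun ξ : ℝ => (sigma ρ k (2 * Real.pi * ξ) : ℂ) := by
  have h1 : Function.HasTemperateGrowth fun ξ : ℝ => 2 * Real.pi * ξ := by fun_prop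
  have h2 := (hρ.hasCompactSupport_sigma k).hasTemperateGrowth (hρ.contDiff_sigma k)
  exact Function.Complex.hasTemperateGrowth_ofReal.comp (h2.comp h1)

/-- The symbol of `□_k S(t)` is a Schwartz function. -/
theorem IsCutoff.exists_schwartz_symbol (hρ : IsCutoff ρ) (k : ℤ) (t : ℝ) :
    ∃ m : 𝓢(ℝ, ℂ), ∀ ξ, m ξ = Complex.exp (-(Complex.I * (t * phi (2 * Real.pi * ξ) : ℝ))) *
      sigma ρ k (2 * Real.pi * ξ) := by
  have hs := (hasTemperateGrowth_groupSymbol t).mul (hρ.hasTemperateGrowth_sigma k)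
  have hc : HasCompactSupport fun ξ : ℝ =>
      Complex.exp (-(Complex.I * (t * phi (2 * Real.pi * ξ) : ℝ))) *
        (sigma ρ k (2 * Real.pi * ξ) : ℂ) := by
    have h1 : HasCompactSupport fun ξ : ℝ => sigma ρ k (2 * Real.pi * ξ) :=
      (hρ.hasCompactSupport_sigma k).comp_homeomorph
        (Homeomorph.mulLeft₀ (2 * Real.pi) (by positivity))
    have h2 : HasCompactSupport fun ξ : ℝ => (sigma ρ k (2 * Real.pi * ξ) : ℂ) :=
      h1.comp_left (g := Complex.ofReal) Complex.ofReal_zero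
    exact h2.mul_left
  exact ⟨hc.toSchwartzMap hs.1, fun _ => rfl⟩

/-- Multipliers compose by multiplying symbols, and `σ_k` absorbs the sum of its neighbours. This
brings in the blocks of `f`, the only pieces of `f` that the modulation norm controls. -/
theorem IsCutoff.box_group_eq (hρ : IsCutoff ρ) (k : ℤ) (t : ℝ) {m : 𝓢(ℝ, ℂ)}
    (hm : ∀ ξ, m ξ = Complex.exp (-(Complex.I * (t * phi (2 * Real.pi * ξ) : ℝ))) *
      sigma ρ k (2 * Real.pi * ξ)) (f : 𝓢'(ℝ, ℂ)) :
    box ρ k (group t f) = ∑ l ∈ Finset.Icc (k - 1) (k + 1),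
      TemperedDistribution.fourierMultiplierCLM ℂ (⇑m) (box ρ l f) := by
  have e1 : box ρ k (group t f) = TemperedDistribution.fourierMultiplierCLM ℂ (⇑m) f := by
    unfold box group multiplier
    rw [TemperedDistribution.fourierMultiplierCLM_fourierMultiplierCLM_apply
      (hasTemperateGrowth_groupSymbol t) (hρ.hasTemperateGrowth_sigma k)]
    congr 2
    ext ξ
    rw [hm]
    rfl
  have e2 : ∀ l, TemperedDistribution.fourierMultiplierCLM ℂ (⇑m) (box ρ l f) =
      TemperedDistribution.fourierMultiplierCLM ℂ
        (fun ξ => (sigma ρ l (2 * Real.pi * ξ) : ℂ) * m ξ) f := fun l => by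
    unfold box multiplier
    rw [TemperedDistribution.fourierMultiplierCLM_fourierMultiplierCLM_apply
      (hρ.hasTemperateGrowth_sigma l) m.hasTemperateGrowth]
    rfl
  have e3 := TemperedDistribution.fourierMultiplierCLM_sum ℂ (s := Finset.Icc (k - 1) (k + 1))
    (g := fun l ξ => (sigma ρ l (2 * Real.pi * ξ) : ℂ) * m ξ)
    (fun l _ => (hρ.hasTemperateGrowth_sigma l).mul m.hasTemperateGrowth)
  have e4 : (fun ξ => ∑ l ∈ Finset.Icc (k - 1) (k + 1), (sigma ρ l (2 * Real.pi * ξ) : ℂ) * m ξ)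
      = ⇑m := by
    ext ξ
    have := hρ.sigma_mul_sum k (2 * Real.pi * ξ)
    rw [← Finset.sum_mul, hm]
    nth_rewrite 2 [← this]
    push_cast
    ring
  rw [e4] at e3
  simp only [e2]
  rw [e1, e3, _root_.sum_apply]

/-- Representatives add because their pairings with Schwartz functions converge absolutely, by
Hölder. -/
theorem lpNorm_add_le {p : ℝ≥0∞} (hp : 1 ≤ p) (f g : 𝓢'(ℝ, ℂ)) :
    lpNorm p (f + g) ≤ lpNorm p f + lpNorm p g := by
  have hint : ∀ (u : 𝓢(ℝ, ℂ)) (G : ℝ → ℂ), MemLp G p volume → Integrable fun x => u x * G x := by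
    intro u G hG
    have : ENNReal.HolderConjugate p (1 - p⁻¹)⁻¹ := ENNReal.HolderConjugate.inv_one_sub_inv' hp
    have : ENNReal.HolderConjugate (1 - p⁻¹)⁻¹ p := ENNReal.HolderConjugate.symm
    exact (u.memLp (1 - p⁻¹)⁻¹).integrable_mul hG
  rw [lpNorm.eq_1 p f, lpNorm.eq_1 p g]
  simp only [ENNReal.iInf_add, ENNReal.add_iInf]
  refine le_iInf fun G => le_iInf fun hG => le_iInf fun hf => le_iInf fun H => le_iInf fun hH =>
    le_iInf fun hg => ?_
  refine (lpNorm_le_eLpNorm (hH.add hG) fun u => ?_).trans (eLpNorm_add_le hH.1 hG.1 hp)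
  have : (f + g) u = f u + g u := rfl
  rw [this, hf, hg, ← integral_add (hint u H hH) (hint u G hG)]
  simp only [Pi.add_apply, mul_add]

theorem lpNorm_zero (p : ℝ≥0∞) : lpNorm p 0 = 0 := by
  have := lpNorm_le_eLpNorm (p := p) (f := 0) (g := 0) MemLp.zero (fun u => by simp)
  simpa using this

theorem lpNorm_sum_le {p : ℝ≥0∞} (hp : 1 ≤ p) {ι : Type*} (s : Finset ι) (f : ι → 𝓢'(ℝ, ℂ)) :
    lpNorm p (∑ i ∈ s, f i) ≤ ∑ i ∈ s, lpNorm p (f i) :=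
  Finset.le_sum_of_subadditive _ (lpNorm_zero p).le (lpNorm_add_le hp) s f

/-- The kernel of `□_k S(t)` as an oscillatory integral over the frequency window. -/
theorem IsCutoff.norm_fourierInv_symbol_le (hρ : IsCutoff ρ) (k : ℤ) (t : ℝ) {m : 𝓢(ℝ, ℂ)}
    (hm : ∀ ξ, m ξ = Complex.exp (-(Complex.I * (t * phi (2 * Real.pi * ξ) : ℝ))) *
      sigma ρ k (2 * Real.pi * ξ)) (x : ℝ) :
    ‖𝓕⁻ m x‖ ≤ ‖∫ ξ in ((k : ℝ) - 1)..(k + 1),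
      Complex.exp (Complex.I * (x * ξ - t * phi ξ : ℝ)) * sigma ρ k ξ‖ := by
  let g : ℝ → ℂ := fun ξ => Complex.exp (Complex.I * (x * ξ - t * phi ξ : ℝ)) * sigma ρ k ξ
  have e1 : 𝓕⁻ m x = ∫ ξ, g (2 * Real.pi * ξ) := by
    rw [SchwartzMap.fourierInv_coe, Real.fourierInv_eq']
    refine integral_congr_ae (Filter.Eventually.of_forall fun ξ => ?_)
    simp only [g, hm, smul_eq_mul, ← mul_assoc, ← Complex.exp_add]
    congr 2
    simp only [RCLike.inner_apply, conj_trivial]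
    push_cast
    ring
  have e2 : ∫ ξ in ((k : ℝ) - 1)..(k + 1), g ξ = ∫ ξ, g ξ := by
    refine intervalIntegral.integral_eq_integral_of_support_subset fun ξ hξ => ?_
    by_contra h
    refine hξ ?_
    simp only [g]
    rw [hρ.sigma_eq_zero k, Complex.ofReal_zero, mul_zero]
    by_contra! h'
    rw [abs_lt] at h'
    exact h ⟨by linarith, by linarith⟩
  -- Rescaling to the angular frequency costs a factor `1/(2π) ≤ 1`, which is dropped.
  rw [e1, Measure.integral_comp_mul_left, e2, norm_smul]
  refine mul_le_of_le_one_left (norm_nonneg _) ?_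
  rw [Real.norm_eq_abs, abs_abs, abs_of_nonneg (by positivity)]
  exact inv_le_one_of_one_le₀ (by linarith [Real.pi_gt_three])

/-- The dispersive bound for the kernel of `□_k S(t)`. -/
theorem IsCutoff.exists_norm_fourierInv_symbol_le (hρ : IsCutoff ρ) :
    ∃ C : ℝ, 0 < C ∧ ∀ (k : ℤ) (t : ℝ) (m : 𝓢(ℝ, ℂ)),
      (∀ ξ, m ξ = Complex.exp (-(Complex.I * (t * phi (2 * Real.pi * ξ) : ℝ))) *
        sigma ρ k (2 * Real.pi * ξ)) → ∀ x,
      ‖𝓕⁻ m x‖ ≤ C * min 1 ((1 + |t|) ^ (-(1 / 3) : ℝ) * (2 + |(k : ℝ)|) ^ (4 / 3 : ℝ)) := by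
  obtain ⟨D, hD⟩ := hρ.exists_abs_deriv_sigma_le
  have hD0 : 0 ≤ D := (abs_nonneg _).trans (hD 0 0)
  refine ⟨2 * (174 + 64 * D), by positivity, fun k t m hm x => ?_⟩
  refine (hρ.norm_fourierInv_symbol_le k t hm x).trans ?_
  set N := 2 + |(k : ℝ)| with hN
  have hN0 : 0 < N := by positivity
  have hN1 : 1 ≤ N ^ (4 / 3 : ℝ) := Real.one_le_rpow (by rw [hN]; linarith [abs_nonneg (k : ℝ)])
    (by norm_num)
  have htriv : ‖∫ ξ in ((k : ℝ) - 1)..(k + 1),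
      Complex.exp (Complex.I * (x * ξ - t * phi ξ : ℝ)) * sigma ρ k ξ‖ ≤ 2 := by
    refine (intervalIntegral.norm_integral_le_of_norm_le_const (C := 1) fun ξ _ => ?_).trans ?_
    · rw [norm_mul, mul_comm Complex.I, Complex.norm_exp_ofReal_mul_I, one_mul, Complex.norm_real]
      exact hρ.abs_sigma_le_one k ξ
    · rw [one_mul, abs_of_nonneg (by linarith)]; linarith
  have hT0 : 0 < 1 + |t| := by positivity
  have h2 : (1 : ℝ) / 2 ≤ 2 ^ (-(1 / 3) : ℝ) := by
    calc (1 : ℝ) / 2 = 2 ^ (-1 : ℝ) := by rw [Real.rpow_neg_one]; norm_num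
      _ ≤ _ := Real.rpow_le_rpow_of_exponent_le (by norm_num) (by norm_num)
  rw [mul_min_of_nonneg _ _ (by positivity)]
  refine le_min (htriv.trans (by linarith)) ?_
  -- For `|t| ≤ 1` the right side is bounded below and the trivial bound `2` suffices. For `|t| >
  -- 1`, `1 + |t| ≤ 2|t|` replaces `|t|` by `1 + |t|` at the cost of a factor `2`.
  rcases le_or_gt |t| 1 with ht | ht
  · have h3 : (1 : ℝ) / 2 ≤ (1 + |t|) ^ (-(1 / 3) : ℝ) :=
      h2.trans (Real.rpow_le_rpow_of_nonpos hT0 (by linarith) (by norm_num))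
    have h4 : (1 : ℝ) / 2 ≤ (1 + |t|) ^ (-(1 / 3) : ℝ) * N ^ (4 / 3 : ℝ) := by
      calc (1 : ℝ) / 2 = 1 / 2 * 1 := by ring
        _ ≤ _ := mul_le_mul h3 hN1 (by norm_num) (by positivity)
    refine htriv.trans ?_
    calc (2 : ℝ) ≤ 2 * (174 + 64 * D) * (1 / 2) := by linarith
      _ ≤ _ := by gcongr
  · have ht0 : 0 < |t| := by linarith
    set δ := |t| ^ (-(1 / 3) : ℝ) * N ^ (4 / 3 : ℝ) with hδ
    have hδ0 : 0 < δ := by positivity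
    have hδ3 : |t| * δ ^ 3 = (2 + |(k : ℝ)|) ^ 4 := by
      rw [hδ, mul_pow, ← Real.rpow_natCast, ← Real.rpow_natCast (N ^ _), ← Real.rpow_mul ht0.le,
        ← Real.rpow_mul hN0.le, ← mul_assoc]
      norm_num
      rw [Real.rpow_neg_one, mul_inv_cancel₀ ht0.ne', one_mul]
    refine (norm_oscillatory_le x (w' := deriv (sigma ρ k))
      (fun ξ => (((hρ.contDiff_sigma k).differentiable (by simp)) ξ).hasDerivAt)
      ((hρ.contDiff_sigma k).continuous_deriv (by simp)) (hρ.abs_sigma_le_one k) (hD k) hδ0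
      hδ3).trans ?_
    have h5 : |t| ^ (-(1 / 3) : ℝ) ≤ 2 * (1 + |t|) ^ (-(1 / 3) : ℝ) := by
      have h6 : (2 * |t|) ^ (-(1 / 3) : ℝ) ≤ (1 + |t|) ^ (-(1 / 3) : ℝ) :=
        Real.rpow_le_rpow_of_nonpos hT0 (by linarith) (by norm_num)
      rw [Real.mul_rpow (by norm_num) ht0.le] at h6
      have h7 : 0 < |t| ^ (-(1 / 3) : ℝ) := by positivity
      nlinarith
    calc (174 + 64 * D) * δ ≤ (174 + 64 * D) * (2 * (1 + |t|) ^ (-(1 / 3) : ℝ) * N ^ (4 / 3 : ℝ)) := by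
          rw [hδ]; gcongr
      _ = _ := by ring

end Block

end BBM

/-! ### Exponents, weights and `ℓ^q` sums. -/

namespace BBM

theorem beta_nonpos {σ : ℝ} (hσ : σ < -1) : beta σ ≤ 0 := by
  unfold beta
  split_ifs
  · exact div_nonpos_of_nonpos_of_nonneg (by linarith) (by linarith)
  · exact div_nonpos_of_nonpos_of_nonneg (by norm_num) (by linarith)

theorem neg_one_third_le_beta {σ : ℝ} (hσ : σ < -1) : -(1 / 3) ≤ beta σ := by
  unfold beta
  split_ifs with h
  · rw [le_div_iff₀ (by linarith)]; linarith
  · rw [le_div_iff₀ (by linarith)]; linarith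

/-- For `σ ≤ -4/3` the bound `β_σ ≥ -1/3` suffices. For `σ` closer to `-1`, `β_σ ≥ -1/4` gives
`-4β_σ ≤ 1 < -σ`. -/
theorem neg_four_mul_beta_le {σ : ℝ} (hσ : σ < -1) : -4 * beta σ ≤ -σ := by
  rcases le_or_gt σ (-4 / 3) with h | h
  · linarith [neg_one_third_le_beta hσ]
  · have : beta σ = (σ + 1) / (1 - 2 * σ) := by
      unfold beta; rw [if_pos (by linarith)]
    have h2 : -(1 / 4) ≤ beta σ := by
      rw [this, le_div_iff₀ (by linarith)]; linarith
    linarith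

theorem modNorm_eq (ρ : ℝ → ℝ) (s : ℝ) (p : ℝ≥0∞) {q : ℝ} (hq : 0 < q) (f : 𝓢'(ℝ, ℂ)) :
    modNorm ρ s p q f = (∑' k : ℤ,
      (ENNReal.ofReal ((1 + |(k : ℝ)|) ^ s) * lpNorm p (box ρ k f)) ^ q) ^ (1 / q) := by
  unfold modNorm
  congr 2
  ext k
  rw [ENNReal.mul_rpow_of_nonneg _ _ hq.le, ENNReal.ofReal_rpow_of_nonneg (by positivity) hq.le,
    ← Real.rpow_mul (by positivity)]

/-- The `ℓ^q` quasi-norm of a sequence dominated by sums over neighbouring indices. -/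
theorem tsum_rpow_le_of_le_sum {u v : ℤ → ℝ≥0∞} {c : ℝ≥0∞} {q : ℝ} (hq : 0 < q)
    (h : ∀ k, v k ≤ c * ∑ l ∈ Finset.Icc (k - 1) (k + 1), u l) :
    (∑' k, v k ^ q) ^ (1 / q) ≤ c * (3 * 3 ^ (1 / q)) * (∑' k, u k ^ q) ^ (1 / q) := by
  have hsum : ∀ (w : ℤ → ℝ≥0∞) (k : ℤ),
      ∑ l ∈ Finset.Icc (k - 1) (k + 1), w l = w (k - 1) + w k + w (k + 1) := fun w k => by
    have : Finset.Icc (k - 1) (k + 1) = {k - 1, k, k + 1} := by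
      ext l
      simp only [Finset.mem_Icc, Finset.mem_insert, Finset.mem_singleton]
      omega
    rw [this, Finset.sum_insert (by simp; omega), Finset.sum_insert (by simp), Finset.sum_singleton,
      add_assoc]
  have h1 : ∀ k, v k ^ q ≤ (c * 3) ^ q * (u (k - 1) ^ q + u k ^ q + u (k + 1) ^ q) := by
    intro k
    -- Passing through the maximum works for every `q > 0`, including `q < 1`: the power of a
    -- maximum is one of the three powers.
    have h2 : u (k - 1) + u k + u (k + 1) ≤ 3 * max (max (u (k - 1)) (u k)) (u (k + 1)) := by
      calc _ ≤ max (max (u (k - 1)) (u k)) (u (k + 1)) + max (max (u (k - 1)) (u k)) (u (k + 1))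
            + max (max (u (k - 1)) (u k)) (u (k + 1)) := by
            gcongr
            · exact (le_max_left _ _).trans (le_max_left _ _)
            · exact (le_max_right _ _).trans (le_max_left _ _)
            · exact le_max_right _ _
        _ = _ := by ring
    have h3 : max (max (u (k - 1)) (u k)) (u (k + 1)) ^ q ≤
        u (k - 1) ^ q + u k ^ q + u (k + 1) ^ q := by
      rcases max_choice (max (u (k - 1)) (u k)) (u (k + 1)) with h' | h'
      · rw [h']
        rcases max_choice (u (k - 1)) (u k) with h'' | h''
        · rw [h'', add_assoc]; exact le_self_add
        · rw [h'', add_comm (u (k - 1) ^ q), add_assoc]; exact le_self_add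
      · rw [h']; exact le_add_self
    calc v k ^ q ≤ (c * 3 * max (max (u (k - 1)) (u k)) (u (k + 1))) ^ q := by
          refine ENNReal.rpow_le_rpow ((h k).trans ?_) hq.le
          rw [hsum, mul_assoc]
          gcongr
      _ = (c * 3) ^ q * max (max (u (k - 1)) (u k)) (u (k + 1)) ^ q :=
          ENNReal.mul_rpow_of_nonneg _ _ hq.le
      _ ≤ _ := by gcongr
  have h4 : ∑' k, v k ^ q ≤ (c * 3) ^ q * (3 * ∑' k, u k ^ q) := by
    calc ∑' k, v k ^ q ≤ ∑' k, (c * 3) ^ q * (u (k - 1) ^ q + u k ^ q + u (k + 1) ^ q) :=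
          ENNReal.tsum_le_tsum h1
      _ = _ := by
          have e1 : ∑' k, u (k - 1) ^ q = ∑' k, u k ^ q :=
            (Equiv.subRight (1 : ℤ)).tsum_eq fun k => u k ^ q
          have e2 : ∑' k, u (k + 1) ^ q = ∑' k, u k ^ q :=
            (Equiv.addRight (1 : ℤ)).tsum_eq fun k => u k ^ q
          rw [ENNReal.tsum_mul_left, ENNReal.tsum_add, ENNReal.tsum_add, e1, e2]
          ring
  calc (∑' k, v k ^ q) ^ (1 / q) ≤ ((c * 3) ^ q * (3 * ∑' k, u k ^ q)) ^ (1 / q) :=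
        ENNReal.rpow_le_rpow h4 (by positivity)
    _ = _ := by
        rw [ENNReal.mul_rpow_of_nonneg _ _ (show 0 ≤ 1 / q by positivity),
          ENNReal.mul_rpow_of_nonneg 3 _ (show 0 ≤ 1 / q by positivity), ← ENNReal.rpow_mul,
          mul_one_div_cancel hq.ne', ENNReal.rpow_one]
        ring

/-- Each of `1 + |k|`, `1 + |l|` is at most twice the other; `|a|` covers both signs of the
exponent. -/
theorem one_add_abs_rpow_le (a : ℝ) {k l : ℤ} (hl : l ∈ Finset.Icc (k - 1) (k + 1)) :
    (1 + |(k : ℝ)|) ^ a ≤ 2 ^ |a| * (1 + |(l : ℝ)|) ^ a := by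
  have hkl : |(k : ℝ) - l| ≤ 1 := by
    rw [Finset.mem_Icc] at hl
    have h1 : (k : ℝ) - 1 ≤ l := by exact_mod_cast hl.1
    have h2 : (l : ℝ) ≤ k + 1 := by exact_mod_cast hl.2
    rw [abs_le]; constructor <;> linarith
  have h1 : |(k : ℝ)| ≤ |(l : ℝ)| + 1 := by
    have := abs_sub_abs_le_abs_sub (k : ℝ) l; linarith
  have h2 : |(l : ℝ)| ≤ |(k : ℝ)| + 1 := by
    have := abs_sub_abs_le_abs_sub (l : ℝ) k; rw [abs_sub_comm] at this; linarith
  have hk := abs_nonneg (k : ℝ)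
  have hl' := abs_nonneg (l : ℝ)
  rcases le_total 0 a with ha | ha
  · rw [abs_of_nonneg ha, ← Real.mul_rpow (by norm_num) (by positivity)]
    exact Real.rpow_le_rpow (by positivity) (by linarith) ha
  · rw [abs_of_nonpos ha]
    have h3 : (2 * (1 + |(k : ℝ)|)) ^ a ≤ (1 + |(l : ℝ)|) ^ a :=
      Real.rpow_le_rpow_of_nonpos (by positivity) (by linarith) ha
    rw [Real.mul_rpow (by norm_num) (by positivity)] at h3
    calc (1 + |(k : ℝ)|) ^ a = 2 ^ (-a) * (2 ^ a * (1 + |(k : ℝ)|) ^ a) := by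
          rw [← mul_assoc, ← Real.rpow_add (by norm_num), neg_add_cancel, Real.rpow_zero, one_mul]
      _ ≤ _ := by gcongr

/-- The interpolated dispersive bound for the blocks of the group. -/
theorem IsCutoff.exists_lpNorm_box_group_le {ρ : ℝ → ℝ} (hρ : IsCutoff ρ) {σ p r θ : ℝ}
    (hσ : σ < -1) (hp : 2 ≤ p) (hpr : p.HolderConjugate r) (hθ : θ ∈ Set.Icc (0 : ℝ) 1) :
    ∃ C : ℝ, 0 < C ∧ ∀ (k : ℤ) (t : ℝ) (f : 𝓢'(ℝ, ℂ)),
      lpNorm (ENNReal.ofReal p) (box ρ k (group t f)) ≤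
        ENNReal.ofReal (C * (1 + |t|) ^ (2 * θ * (1 / 2 - 1 / p) * beta σ) *
          (1 + |(k : ℝ)|) ^ (-(σ * θ))) *
        ∑ l ∈ Finset.Icc (k - 1) (k + 1), lpNorm (ENNReal.ofReal r) (box ρ l f) := by
  obtain ⟨C₀, hC₀, hK⟩ := hρ.exists_norm_fourierInv_symbol_le
  have hp0 : 0 < p := by linarith
  have hP0 : 0 ≤ 1 - 2 / p := by rw [sub_nonneg, div_le_one hp0]; exact hp
  have hP1 : 1 - 2 / p ≤ 1 := by linarith [show 0 < 2 / p by positivity]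
  have hβ0 := beta_nonpos hσ
  have hβ1 := neg_one_third_le_beta hσ
  have hβ2 := neg_four_mul_beta_le hσ
  refine ⟨C₀ ^ (1 - 2 / p) * 2 ^ (-(σ * θ)), by positivity, fun k t f => ?_⟩
  obtain ⟨m, hm⟩ := hρ.exists_schwartz_symbol k t
  set T := 1 + |t| with hT
  have hT0 : 0 < T := by positivity
  set N := 2 + |(k : ℝ)| with hN
  have hN0 : 0 < N := by positivity
  have hN1 : 1 ≤ N := by rw [hN]; linarith [abs_nonneg (k : ℝ)]
  set Q := T ^ (-(1 / 3) : ℝ) * N ^ (4 / 3 : ℝ) with hQ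
  have hQ0 : 0 < Q := by positivity
  -- Chosen so that `Q^γ` contains `(1 + |t|)^(β_σθ)`; raised to the power `1 - 2/p` this is the
  -- claimed decay.
  set γ := -3 * beta σ * θ with hγ
  have hγ0 : 0 ≤ γ := mul_nonneg (by linarith) hθ.1
  have hγ1 : γ ≤ 1 := mul_le_one₀ (by linarith) hθ.1 hθ.2
  have hmin : min 1 Q ≤ Q ^ γ := by
    rcases le_total 1 Q with h | h
    · exact (min_le_left _ _).trans (Real.one_le_rpow h hγ0)
    · refine (min_le_right _ _).trans ?_
      calc Q = Q ^ (1 : ℝ) := (Real.rpow_one Q).symm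
        _ ≤ _ := Real.rpow_le_rpow_of_exponent_ge hQ0 h hγ1
  have hA0 : 0 < C₀ * Q ^ γ := by positivity
  have hA : ∀ x, ‖FourierTransformInv.fourierInv m x‖ ≤ C₀ * Q ^ γ := fun x =>
    (hK k t m hm x).trans (mul_le_mul_of_nonneg_left hmin hC₀.le)
  have hm1 : ∀ ξ, ‖m ξ‖ ≤ 1 := fun ξ => by
    rw [hm, norm_mul, ← mul_neg, ← Complex.ofReal_neg, mul_comm Complex.I,
      Complex.norm_exp_ofReal_mul_I, one_mul, Complex.norm_real]
    exact hρ.abs_sigma_le_one k _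
  have hbound : (C₀ * Q ^ γ) ^ (1 - 2 / p) ≤ C₀ ^ (1 - 2 / p) * 2 ^ (-(σ * θ)) *
      T ^ (2 * θ * (1 / 2 - 1 / p) * beta σ) * (1 + |(k : ℝ)|) ^ (-(σ * θ)) := by
    have e1 : (C₀ * Q ^ γ) ^ (1 - 2 / p) = C₀ ^ (1 - 2 / p) *
        (T ^ (2 * θ * (1 / 2 - 1 / p) * beta σ) * N ^ (-4 * beta σ * θ * (1 - 2 / p))) := by
      rw [Real.mul_rpow hC₀.le (by positivity), ← Real.rpow_mul hQ0.le, hQ,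
        Real.mul_rpow (by positivity) (by positivity), ← Real.rpow_mul hT0.le,
        ← Real.rpow_mul hN0.le]
      congr 3
      · rw [hγ]; ring
      · rw [hγ]; ring
    have e2 : N ^ (-4 * beta σ * θ * (1 - 2 / p)) ≤
        2 ^ (-(σ * θ)) * (1 + |(k : ℝ)|) ^ (-(σ * θ)) := by
      have hexp : -4 * beta σ * θ * (1 - 2 / p) ≤ -(σ * θ) := by
        have h1 : 0 ≤ -4 * beta σ * θ := mul_nonneg (by linarith) hθ.1
        calc -4 * beta σ * θ * (1 - 2 / p) ≤ -4 * beta σ * θ := mul_le_of_le_one_right h1 hP1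
          _ ≤ -σ * θ := mul_le_mul_of_nonneg_right hβ2 hθ.1
          _ = _ := by ring
      have hσθ : 0 ≤ -(σ * θ) := by
        have := mul_nonneg (show 0 ≤ -σ by linarith) hθ.1
        linarith
      rw [← Real.mul_rpow (by norm_num) (by positivity)]
      refine (Real.rpow_le_rpow_of_exponent_le hN1 hexp).trans
        (Real.rpow_le_rpow hN0.le ?_ hσθ)
      rw [hN]; linarith [abs_nonneg (k : ℝ)]
    rw [e1]
    calc _ ≤ C₀ ^ (1 - 2 / p) * (T ^ (2 * θ * (1 / 2 - 1 / p) * beta σ) *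
          (2 ^ (-(σ * θ)) * (1 + |(k : ℝ)|) ^ (-(σ * θ)))) := by gcongr
      _ = _ := by ring
  rw [hρ.box_group_eq k t hm]
  refine (lpNorm_sum_le (by simpa using hpr.lt.le) _ _).trans ?_
  rw [Finset.mul_sum]
  refine Finset.sum_le_sum fun l _ => ?_
  refine (lpNorm_fourierMultiplierCLM_le hm1 hA0 hA hp hpr _).trans ?_
  gcongr

end BBM

/-- The estimate is in `[0, ∞]` with `C` finite, so a finite right side also gives `S(t)f ∈
M^s_{p,q}`. -/
theorem mainTheorem8 (ρ : ℝ → ℝ) (hρ : BBM.IsCutoff ρ) (s σ p p' q θ : ℝ) (hσ : σ < -1)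
    (hp : 2 ≤ p) (hpp' : 1 / p + 1 / p' = 1) (hq : 0 < q) (hθ : θ ∈ Set.Icc (0 : ℝ) 1) :
    ∃ C : ℝ≥0, ∀ (t : ℝ) (f : 𝓢'(ℝ, ℂ)),
      BBM.modNorm ρ s (ENNReal.ofReal p) q (BBM.group t f) ≤
        C * ENNReal.ofReal ((1 + |t|) ^ (2 * θ * (1 / 2 - 1 / p) * BBM.beta σ)) *
          BBM.modNorm ρ (s - σ * θ) (ENNReal.ofReal p') q f := by
  have hpr : p.HolderConjugate p' := by
    rw [Real.holderConjugate_iff]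
    exact ⟨by linarith, by simpa [one_div] using hpp'⟩
  obtain ⟨C, hC, hb⟩ := hρ.exists_lpNorm_box_group_le hσ hp hpr hθ
  -- The factor `2 ^ |s - σθ|` pays for moving the weight from `k` to its neighbours, and `3 * 3 ^
  -- (1/q)` for summing over them.
  set K : ℝ≥0∞ := ENNReal.ofReal (C * 2 ^ |s - σ * θ|) * (3 * 3 ^ (1 / q)) with hK
  have hKtop : K ≠ ⊤ := by
    refine ENNReal.mul_ne_top ENNReal.ofReal_ne_top (ENNReal.mul_ne_top (by simp) ?_)
    exact ENNReal.rpow_ne_top_of_nonneg (by positivity) (by simp)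
  refine ⟨K.toNNReal, fun t f => ?_⟩
  rw [ENNReal.coe_toNNReal hKtop, BBM.modNorm_eq _ _ _ hq, BBM.modNorm_eq _ _ _ hq]
  set τ := (1 + |t|) ^ (2 * θ * (1 / 2 - 1 / p) * BBM.beta σ) with hτ
  have hτ0 : 0 ≤ τ := by positivity
  have key := BBM.tsum_rpow_le_of_le_sum hq
    (u := fun k : ℤ => ENNReal.ofReal ((1 + |(k : ℝ)|) ^ (s - σ * θ)) *
      BBM.lpNorm (ENNReal.ofReal p') (BBM.box ρ k f))
    (v := fun k : ℤ => ENNReal.ofReal ((1 + |(k : ℝ)|) ^ s) *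
      BBM.lpNorm (ENNReal.ofReal p) (BBM.box ρ k (BBM.group t f)))
    (c := ENNReal.ofReal (C * 2 ^ |s - σ * θ| * τ)) fun k => ?_
  · refine key.trans (le_of_eq ?_)
    rw [hK, ENNReal.ofReal_mul (by positivity)]
    ring
  · refine (mul_le_mul_right (hb k t f) _).trans ?_
    rw [Finset.mul_sum, Finset.mul_sum, Finset.mul_sum]
    refine Finset.sum_le_sum fun l hl => ?_
    rw [← mul_assoc, ← mul_assoc, ← ENNReal.ofReal_mul (by positivity),
      ← ENNReal.ofReal_mul (by positivity)]
    refine mul_le_mul_left (ENNReal.ofReal_le_ofReal ?_) _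
    have h1 : (1 + |(k : ℝ)|) ^ s * (1 + |(k : ℝ)|) ^ (-(σ * θ)) =
        (1 + |(k : ℝ)|) ^ (s - σ * θ) := by
      rw [← Real.rpow_add (by positivity), sub_eq_add_neg]
    calc (1 + |(k : ℝ)|) ^ s * (C * τ * (1 + |(k : ℝ)|) ^ (-(σ * θ)))
        = C * τ * (1 + |(k : ℝ)|) ^ (s - σ * θ) := by rw [← h1]; ring
      _ ≤ C * τ * (2 ^ |s - σ * θ| * (1 + |(l : ℝ)|) ^ (s - σ * θ)) := by
          gcongr
          exact BBM.one_add_abs_rpow_le _ hl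
      _ = _ := by ring
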